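/- Let $p$ be an odd prime, $F$ a field of characteristic $p$, and $L=\bigoplus_{i\ge 1}L_i$ an infinite-dimensional graded Lie algebra of maximal class over $F$; that is, $\dim L_1=2$, $\dim L_i\le 1$ for $i\ge 2$, and $L$ is generated by $L_1$. For $i\ge 2$ let $C_i=\{u\in L_1 : [L_i,u]=0\}$ be the two-step centralizers of $L$, and suppose that at least three of the subspaces $C_i$ $(i\ge 2)$ are distinct. Call the least $n$ with $C_n\ne C_2$ the length of the first constituent $C_2,\dots,C_n$. Every other constituent is a segment $C_{i+1},\dots,C_{i+m}$ with $i\ge 2$, $m\ge 1$, $C_i\ne C_2$, $C_{i+m}\ne C_2$ and $C_{i+1}=\dots=C_{i+m-1}=C_2$; its length is $m$. Then the first constituent has length $2q$, where $q=p^h$ for some $h\ge 1$, and every constituent of $L$ is either short (of length $q$) or long (of length $2q$). Moreover $L$ is inflated: there is a one-dimensional subspace $M$ of $(L^{\downarrow})_1$ such that $L$ is isomorphic, as a graded Lie algebra, to the inflation ${}^{M}(L^{\downarrow})$ of its deflation $L^{\downarrow}$. Here: * The deflation is $L^{\downarrow}=\bigl(\bigoplus_{i\ge 1}L_{pi}\bigr)\oplus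 F\delta$, the extension of the subalgebra $\bigoplus_{i\ge1} L_{pi}$ by its derivation $\delta=(\operatorname{ad}x)^p$, where $x\in L_1\setminus C_2$ (the choice of $x$ does not matter up to graded isomorphism); $L_{pi}$ has weight $i$ and $\delta$ has weight $1$. * For a graded Lie algebra $N=\bigoplus_{i\ge1}N_i$ of maximal class and a one-dimensional subspace $M$ of $N_1$, let $I=M\oplus\bigoplus_{i\ge 2}N_i$ and $s\in N_1\setminus M$. The inflation is ${}^{M}N=\bigl(F[\varepsilon]/(\varepsilon^p)\otimes_F I\bigr)\oplus FD$, the extension by the derivation $D=\frac{d}{d\varepsilon}\otimes 1+\varepsilon^{p-1}\otimes\operatorname{ad}s$ (the choice of $s$ does not matter up to graded isomorphism); $\varepsilon^j\otimes m$ has weight $pi-j$ for $m\in I\cap N_i$ and $0\le j<p$, and $D$ has weight $1$. -/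

import Mathlib

open scoped TensorProduct Polynomial

namespace MaximalClass

/-! ### Graded Lie algebras of maximal class, two-step centralizers, constituents -/

section Basic

variable {F L : Type*} [Field F] [LieRing L] [LieAlgebra F L]

/-- A Lie algebra `L = ⨁_{i ≥ 1} L_i` (the grading is indexed by `ℕ`, with `L_0 = 0`) is of
maximal class when `dim L_1 = 2`, `dim L_i ≤ 1` for `i ≥ 2`, and `L_1` generates `L`. -/
structure IsMaximalClass (𝒜 : ℕ → Submodule F L) [GradedLieAlgebra 𝒜] : Prop where
  zero_eq_bot : 𝒜 0 = ⊥
  rank_one : Module.rank F (𝒜 1) = 2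
  rank_le_one : ∀ i, 2 ≤ i → Module.rank F (𝒜 i) ≤ 1
  generated : LieSubalgebra.lieSpan F L (𝒜 1 : Set L) = ⊤

/-- `C_i = C_{L_1}(L_i)`, the centralizer of `L_i` in `L_1`. -/
def twoStepCentralizer (𝒜 : ℕ → Submodule F L) (i : ℕ) : Submodule F L where
  carrier := {u | u ∈ 𝒜 1 ∧ ∀ v ∈ 𝒜 i, ⁅v, u⁆ = 0}
  add_mem' := fun ha hb =>
    ⟨add_mem ha.1 hb.1, fun v hv => by rw [lie_add, ha.2 v hv, hb.2 v hv, add_zero]⟩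
  zero_mem' := ⟨zero_mem _, fun v _ => lie_zero v⟩
  smul_mem' := fun c _ ha =>
    ⟨Submodule.smul_mem _ c ha.1, fun v hv => by rw [lie_smul, ha.2 v hv, smul_zero]⟩

/-- The set of two-step centralizers `{C_i : i ≥ 2}`. -/
def twoStepCentralizers (𝒜 : ℕ → Submodule F L) : Set (Submodule F L) :=
  {C | ∃ i, 2 ≤ i ∧ C = twoStepCentralizer 𝒜 i}

/-- The second two-step centralizer (in order of occurrence) first occurs in weight `n`. -/
def SecondOccursAt (𝒜 : ℕ → Submodule F L) (n : ℕ) : Prop :=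
  2 ≤ n ∧ twoStepCentralizer 𝒜 n ≠ twoStepCentralizer 𝒜 2 ∧
    ∀ j, 2 ≤ j → j < n → twoStepCentralizer 𝒜 j = twoStepCentralizer 𝒜 2

/-- `q` is the parameter: the second two-step centralizer first occurs in weight `2q`. -/
def IsParameter (𝒜 : ℕ → Submodule F L) (q : ℕ) : Prop :=
  SecondOccursAt 𝒜 (2 * q)

/-- `IsConstituent 𝒜 a b m` means that `C_a, C_{a+1}, …, C_b` is a constituent, of length `m`.
The first constituent `C_2, …, C_n` is given the length `n` by convention. -/
inductive IsConstituent (𝒜 : ℕ → Submodule F L) : ℕ → ℕ → ℕ → Prop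
  | first (n : ℕ) (h : SecondOccursAt 𝒜 n) : IsConstituent 𝒜 2 n n
  | later (i m : ℕ) (hi : 2 ≤ i) (hm : 1 ≤ m)
      (hstart : twoStepCentralizer 𝒜 i ≠ twoStepCentralizer 𝒜 2)
      (hend : twoStepCentralizer 𝒜 (i + m) ≠ twoStepCentralizer 𝒜 2)
      (hmid : ∀ j, 1 ≤ j → j < m → twoStepCentralizer 𝒜 (i + j) = twoStepCentralizer 𝒜 2) :
      IsConstituent 𝒜 (i + 1) (i + m) m

end Basic

/-! ### Extension of a Lie algebra by a derivation -/

section DerivExt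

variable {F K : Type*} [Field F] [LieRing K] [LieAlgebra F K]

/-- The Lie algebra `K ⊕ F·D`, with `⁅D, a⁆ = D a` for `a ∈ K`. The pair `⟨a, t⟩` stands for
`a + t D`. -/
@[ext] structure DerivExt (D : LieDerivation F K K) where
  left : K
  right : F

namespace DerivExt

variable (D : LieDerivation F K K)

variable {D} in
def toProd : DerivExt D ≃ K × F where
  toFun x := ⟨x.left, x.right⟩
  invFun x := ⟨x.1, x.2⟩
  left_inv _ := rfl
  right_inv _ := rfl

instance : AddCommGroup (DerivExt D) := toProd.addCommGroup

instance : Module F (DerivExt D) := toProd.module F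

instance : Bracket (DerivExt D) (DerivExt D) where
  bracket x y := ⟨⁅x.left, y.left⁆ + x.right • D y.left - y.right • D x.left, 0⟩

@[simp] lemma zero_eq_mk : (0 : DerivExt D) = ⟨0, 0⟩ := rfl
@[simp] lemma add_eq_mk (x y : DerivExt D) :
    x + y = ⟨x.left + y.left, x.right + y.right⟩ := rfl
@[simp] lemma smul_eq_mk (t : F) (x : DerivExt D) :
    t • x = ⟨t • x.left, t • x.right⟩ := rfl
@[simp] lemma lie_eq_mk (x y : DerivExt D) :
    ⁅x, y⁆ = ⟨⁅x.left, y.left⁆ + x.right • D y.left - y.right • D x.left, 0⟩ := rfl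

instance : LieRing (DerivExt D) where
  add_lie x y z := by
    ext
    · simp [add_smul]; abel
    · simp
  lie_add x y z := by
    ext
    · simp [add_smul]; abel
    · simp
  lie_self x := by simp
  leibniz_lie x y z := by
    ext
    · simp only [lie_eq_mk, add_eq_mk, lie_add, lie_sub, add_lie, sub_lie, lie_smul, smul_lie,
        map_add, map_sub, map_smul, smul_add, smul_sub, zero_smul,
        LieDerivation.apply_lie_eq_add, smul_smul, mul_comm y.right x.right,
        mul_comm z.right x.right, mul_comm z.right y.right]
      rw [leibniz_lie x.left, ← lie_skew (D x.left) z.left, ← lie_skew (D y.left) z.left,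
        ← lie_skew (D x.left) y.left]
      simp only [smul_neg]
      abel
    · simp

instance : LieAlgebra F (DerivExt D) where
  lie_smul t x y := by
    ext
    · simp [smul_sub, smul_add, smul_smul, mul_comm]
    · simp

/-- The inclusion of `K` in `K ⊕ F·D`. -/
def inl : K →ₗ[F] DerivExt D where
  toFun a := ⟨a, 0⟩
  map_add' _ _ := by simp
  map_smul' _ _ := by simp

/-- The element `D` of `K ⊕ F·D`. -/
def gen : DerivExt D := ⟨0, 1⟩

end DerivExt

end DerivExt

/-! ### Deflation -/

section Deflation

variable {F L : Type*} [Field F] [LieRing L] [LieAlgebra F L]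

/-- The subalgebra `⨁_i L_{pi}` of a graded Lie algebra. -/
def multiplesSubalgebra (p : ℕ) (𝒜 : ℕ → Submodule F L) [SetLike.GradedBracket 𝒜] :
    LieSubalgebra F L where
  toSubmodule := ⨆ i, 𝒜 (p * i)
  lie_mem' := by
    intro a b ha hb
    change a ∈ ⨆ i, 𝒜 (p * i) at ha
    change b ∈ ⨆ i, 𝒜 (p * i) at hb
    change ⁅a, b⁆ ∈ ⨆ i, 𝒜 (p * i)
    induction ha using Submodule.iSup_induction' with
    | zero => simp
    | add x y _ _ hx hy => rw [add_lie]; exact add_mem hx hy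
    | mem i x hx =>
      induction hb using Submodule.iSup_induction' with
      | zero => simp
      | add y z _ _ hy hz => rw [lie_add]; exact add_mem hy hz
      | mem j y hy =>
        refine Submodule.mem_iSup_of_mem (i + j) ?_
        rw [mul_add]
        exact SetLike.GradedBracket.bracket_mem hx hy

lemma ad_pow_mem (𝒜 : ℕ → Submodule F L) [SetLike.GradedBracket 𝒜] {x : L} (hx : x ∈ 𝒜 1)
    (n i : ℕ) {a : L} (ha : a ∈ 𝒜 i) : (LieAlgebra.ad F L x ^ n) a ∈ 𝒜 (i + n) := by
  induction n with
  | zero => simpa using ha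
  | succ n ih =>
    rw [pow_succ', Module.End.mul_apply, LieAlgebra.ad_apply,
      show i + (n + 1) = 1 + (i + n) by ring]
    exact SetLike.GradedBracket.bracket_mem hx ih

lemma ad_pow_mem_multiples (p : ℕ) (𝒜 : ℕ → Submodule F L) [SetLike.GradedBracket 𝒜] {x : L}
    (hx : x ∈ 𝒜 1) (a : L) (ha : a ∈ multiplesSubalgebra p 𝒜) :
    (LieAlgebra.ad F L x ^ p) a ∈ multiplesSubalgebra p 𝒜 := by
  change a ∈ ⨆ i, 𝒜 (p * i) at ha
  change _ ∈ ⨆ i, 𝒜 (p * i)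
  induction ha using Submodule.iSup_induction' with
  | zero => simp
  | add y z _ _ hy hz => rw [map_add]; exact add_mem hy hz
  | mem i y hy =>
    refine Submodule.mem_iSup_of_mem (i + 1) ?_
    rw [mul_add, mul_one]
    exact ad_pow_mem 𝒜 hx p _ hy

/-- In characteristic `p`, the `p`-th power of an inner derivation is a derivation. -/
lemma ad_pow_char_lie (p : ℕ) [hp : Fact p.Prime] [CharP F p] (x a b : L) :
    (LieAlgebra.ad F L x ^ p) ⁅a, b⁆ =
      ⁅(LieAlgebra.ad F L x ^ p) a, b⁆ + ⁅a, (LieAlgebra.ad F L x ^ p) b⁆ := by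
  have key := LieDerivation.iterate_apply_lie' (LieDerivation.ad F L x) p a b
  have hfun : (⇑(LieDerivation.ad F L x)) = ⇑(LieAlgebra.ad F L x) := by
    funext y; simp
  rw [hfun] at key
  simp only [← Module.End.pow_apply] at key
  obtain ⟨n, hn⟩ : ∃ n, p = n + 1 := ⟨p - 1, (Nat.succ_pred_prime hp.out).symm⟩
  rw [key, Finset.sum_range_succ]
  rw [show Finset.range p = Finset.range (n + 1) by rw [hn], Finset.sum_range_succ',
    Finset.sum_eq_zero]
  · simp [add_comm]
  · intro i hi
    have hlt : i + 1 < p := by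
      have := Finset.mem_range.mp hi
      omega
    have hdvd : p ∣ p.choose (i + 1) := hp.out.dvd_choose_self (Nat.succ_ne_zero i) hlt
    rw [← Nat.cast_smul_eq_nsmul F, (CharP.cast_eq_zero_iff F p _).mpr hdvd, zero_smul]

/-- The derivation of `⨁_i L_{pi}` induced by `(ad x)^p`, for `x ∈ L_1`. -/
def adPowDerivation (p : ℕ) [Fact p.Prime] [CharP F p] (𝒜 : ℕ → Submodule F L)
    [SetLike.GradedBracket 𝒜] (x : 𝒜 1) :
    LieDerivation F (multiplesSubalgebra p 𝒜) (multiplesSubalgebra p 𝒜) where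
  toLinearMap := (LieAlgebra.ad F L (x : L) ^ p).restrict
    (p := (multiplesSubalgebra p 𝒜).toSubmodule) (q := (multiplesSubalgebra p 𝒜).toSubmodule)
    (ad_pow_mem_multiples p 𝒜 x.2)
  leibniz' a b := by
    apply Subtype.ext
    have := ad_pow_char_lie (F := F) p (x : L) (a : L) (b : L)
    change (LieAlgebra.ad F L (x : L) ^ p) ⁅(a : L), (b : L)⁆ =
      ⁅(a : L), (LieAlgebra.ad F L (x : L) ^ p) (b : L)⁆ -
        ⁅(b : L), (LieAlgebra.ad F L (x : L) ^ p) (a : L)⁆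
    rw [this, ← lie_skew (b : L)]
    abel

/-- The deflation of `L`: the algebra `⨁_i L_{pi}` extended by the derivation `(ad x)^p`.
Here `x ∈ L_1` is an element outside `C_2`; up to isomorphism of graded algebras the deflation of
an algebra of maximal class does not depend on `x`. -/
abbrev Deflation (p : ℕ) [Fact p.Prime] [CharP F p] (𝒜 : ℕ → Submodule F L)
    [SetLike.GradedBracket 𝒜] (x : 𝒜 1) : Type _ :=
  DerivExt (adPowDerivation p 𝒜 x)

/-- The grading of the deflation: `L_{pk}` has weight `k`, and `(ad x)^p` has weight `1`. -/
def deflationGrading (p : ℕ) [Fact p.Prime] [CharP F p] (𝒜 : ℕ → Submodule F L)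
    [SetLike.GradedBracket 𝒜] (x : 𝒜 1) (k : ℕ) : Submodule F (Deflation p 𝒜 x) :=
  ((𝒜 (p * k)).comap (multiplesSubalgebra p 𝒜).toSubmodule.subtype).map (DerivExt.inl _) ⊔
    if k = 1 then Submodule.span F {DerivExt.gen (adPowDerivation p 𝒜 x)} else ⊥

end Deflation

/-! ### Inflation -/

section Inflation

/-- The truncated polynomial algebra `F[ε]` with `ε ^ p = 0`. -/
abbrev Trunc (F : Type*) [Field F] (p : ℕ) : Type _ :=
  F[X] ⧸ Ideal.span {(Polynomial.X : F[X]) ^ p}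

/-- The class `ε` of the indeterminate. -/
noncomputable def eps (F : Type*) [Field F] (p : ℕ) : Trunc F p :=
  Ideal.Quotient.mk _ Polynomial.X

lemma derivative_trunc (F : Type*) [Field F] (p : ℕ) [CharP F p] (f : F[X])
    (hf : Ideal.Quotient.mkₐ F (Ideal.span {(Polynomial.X : F[X]) ^ p}) f = 0) :
    Ideal.Quotient.mkₐ F (Ideal.span {(Polynomial.X : F[X]) ^ p})
      (Polynomial.derivative' f) = 0 := by
  rw [Ideal.Quotient.mkₐ_eq_mk, Ideal.Quotient.eq_zero_iff_mem, Ideal.mem_span_singleton] at hf ⊢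
  obtain ⟨g, rfl⟩ := hf
  refine ⟨Polynomial.derivative g, ?_⟩
  simp [Polynomial.derivative']

/-- The derivation `∂ = d/dε` of `F[ε]`, well defined since `F` has characteristic `p`. -/
noncomputable def truncDerivation (F : Type*) [Field F] (p : ℕ) [CharP F p] :
    Derivation F (Trunc F p) (Trunc F p) :=
  Derivation.liftOfSurjective (d := (Polynomial.derivative' : Derivation F F[X] F[X]))
    (Ideal.Quotient.mkₐ_surjective F (Ideal.span {(Polynomial.X : F[X]) ^ p}))
    (derivative_trunc F p)

variable {F N : Type*} [Field F] [LieRing N] [LieAlgebra F N]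

/-- The derivation `m ↦ ⁅s, m⁆` of an ideal `I` of `N`, for `s ∈ N`. -/
def adIdeal (I : LieIdeal F N) (s : N) : LieDerivation F I I where
  toLinearMap := LieModule.toEnd F N I s
  leibniz' a b := by
    apply Subtype.ext
    change ⁅s, ⁅(a : N), (b : N)⁆⁆ = ⁅(a : N), ⁅s, (b : N)⁆⁆ - ⁅(b : N), ⁅s, (a : N)⁆⁆
    rw [leibniz_lie s, ← lie_skew (b : N)]
    abel

/-- The derivation `D = ∂ ⊗ 1 + ε^{p-1} ⊗ ad s` of `F[ε] ⊗ I`. -/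
noncomputable def inflationDerivation (p : ℕ) [CharP F p] (I : LieIdeal F N) (s : N) :
    LieDerivation F (Trunc F p ⊗[F] I) (Trunc F p ⊗[F] I) :=
  Lie.Derivation.ofDerivation I (truncDerivation F p) +
    eps F p ^ (p - 1) • Lie.Derivation.ofLieDerivation (Trunc F p) (adIdeal I s)

/-- The inflation of a graded algebra `N` of maximal class: if `I = M ⊕ ⨁_{i ≥ 2} N_i`, where `M`
is a one-dimensional subspace of `N_1`, and `s ∈ N_1 ∖ M`, then it is `F[ε] ⊗ I` extended by the
derivation `D = ∂ ⊗ 1 + ε^{p-1} ⊗ ad s`. -/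
abbrev Inflation (p : ℕ) [CharP F p] (I : LieIdeal F N) (s : N) : Type _ :=
  DerivExt (inflationDerivation p I s)

/-- The grading of the inflation: for `m ∈ I` of weight `i` in `N` and `0 ≤ j < p`, the element
`ε^j ⊗ m` has weight `p i - j`; the derivation `D` has weight `1`. -/
noncomputable def inflationGrading (p : ℕ) [CharP F p] (ℬ : ℕ → Submodule F N) (I : LieIdeal F N)
    (s : N) (k : ℕ) : Submodule F (Inflation p I s) :=
  Submodule.span F {v | ∃ (i j : ℕ) (m : I), j < p ∧ k + j = p * i ∧ (m : N) ∈ ℬ i ∧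
      v = DerivExt.inl _ ((eps F p ^ j) ⊗ₜ[F] m)} ⊔
    if k = 1 then Submodule.span F {DerivExt.gen (inflationDerivation p I s)} else ⊥

end Inflation

section Inflated

variable {F L : Type*} [Field F] [LieRing L] [LieAlgebra F L]

/-- `L` is inflated: it is isomorphic, as a graded Lie algebra, to the inflation of its deflation
with respect to a one-dimensional subspace `M` of the weight one component of the deflation. -/
def IsInflated (p : ℕ) [Fact p.Prime] [CharP F p] (𝒜 : ℕ → Submodule F L)
    [SetLike.GradedBracket 𝒜] : Prop :=
  ∃ x : 𝒜 1, (x : L) ∉ twoStepCentralizer 𝒜 2 ∧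
  ∃ M : Submodule F (Deflation p 𝒜 x),
    M ≤ deflationGrading p 𝒜 x 1 ∧ Module.finrank F M = 1 ∧
  ∃ I : LieIdeal F (Deflation p 𝒜 x),
    I.toSubmodule = M ⊔ (⨆ i, ⨆ (_ : 2 ≤ i), deflationGrading p 𝒜 x i) ∧
  ∃ s ∈ deflationGrading p 𝒜 x 1, s ∉ M ∧
  ∃ e : L ≃ₗ⁅F⁆ Inflation p I s,
    ∀ k, (𝒜 k).map (e : L →ₗ[F] Inflation p I s) =
      inflationGrading p (deflationGrading p 𝒜 x) I s k

end Inflated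

end MaximalClass

/-!
Choose `x ∈ L_1 ∖ C_2`, a nonzero `y ∈ C_2`, and nonzero weight vectors `v 1 = y, v 2, …`. After
extending the scalars to `F(X)`, the element `x + X y` lies outside all the two-step centralizers,
so that the `v k` can be rescaled to make it act as `v k ↦ v (k + 1)`. Then `L` is encoded by the
single sequence `f` with `⁅y, v k⁆ = f k • v (k + 1)`: for `k ≥ 2` the term `f k` determines `C_k`,
it vanishes exactly when `C_k = C_2`, and the Jacobi identity becomes a family of identities between
iterated forward differences of `f`.

These identities and Lucas' theorem force the first nonzero term of `f` to have index `2 q`, where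
`q` is a power of `p`. As
`(X - 1) ^ (n q - 1) = (X ^ q - 1) ^ (n - 1) * (1 + X + ⋯ + X ^ (q - 1))` in characteristic `p`,
iterated differences of step `1` turn into iterated differences of step `q` of the sums of `f` over
windows of length `q`. The index of the first nonzero term different from `f (2 q)`, which exists
because there is a third two-step centralizer, is congruent modulo `q` to those of the preceding
nonzero terms, whereas the first nonzero term at an index not divisible by `q` would have to be
equal to all the preceding ones. Hence all the nonzero terms sit at multiples of `q`.

Hence `y` acts nontrivially only on components of weight divisible by `p`, and `v (p i - j)`, for
`0 ≤ j < p`, behaves like `ε ^ j / j! ⊗ v (p i)`. This identifies `L` with the inflation of its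
deflation.
-/

namespace MaximalClass

open fwdDiff

section ForwardDifferences

variable {G R : Type*} [AddCommGroup G] [CommRing R] {h n i j : ℕ}

lemma fwdDiff_iter_eq_zero {f : ℕ → G} (hf : ∀ k ≤ n, f (i + k * h) = 0) :
    Δ_[h] ^[n] f i = 0 := by
  rw [fwdDiff_iter_eq_sum_shift]
  refine Finset.sum_eq_zero fun k hk => ?_
  rw [smul_eq_mul, hf k (Finset.mem_range_succ_iff.mp hk), smul_zero]

lemma fwdDiff_iter_eq_single {f : ℕ → R} {r : ℕ} (hr : r ≤ n)
    (hf : ∀ k ≤ n, k ≠ r → f (i + k * h) = 0) :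
    Δ_[h] ^[n] f i = (-1) ^ (n - r) * n.choose r * f (i + r * h) := by
  rw [fwdDiff_iter_eq_sum_shift, Finset.sum_eq_single_of_mem r (Finset.mem_range_succ_iff.mpr hr)]
  · simp [zsmul_eq_mul]
  · intro k hk hkr
    rw [smul_eq_mul, hf k (Finset.mem_range_succ_iff.mp hk) hkr, smul_zero]

lemma fwdDiff_iter_eq_first {f : ℕ → R} (hf : ∀ k ≤ n, 1 ≤ k → f (i + k * h) = 0) :
    Δ_[h] ^[n] f i = (-1) ^ n * f i := by
  rw [fwdDiff_iter_eq_single n.zero_le fun k hk hk0 => hf k hk (Nat.one_le_iff_ne_zero.mpr hk0)]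
  simp

lemma fwdDiff_iter_sub_fwdDiff_iter {f : ℕ → G}
    (hf : ∀ k < n, f (i + k * h) = f (j + k * h)) :
    Δ_[h] ^[n] f i - Δ_[h] ^[n] f j = f (i + n * h) - f (j + n * h) := by
  simp only [fwdDiff_iter_eq_sum_shift, smul_eq_mul]
  rw [← Finset.sum_sub_distrib, Finset.sum_range_succ, Finset.sum_eq_zero]
  · simp
  · intro k hk
    rw [hf k (Finset.mem_range.mp hk), sub_self]

lemma fwdDiff_iter_eq_last {f : ℕ → R} (hf : ∀ k < n, f (i + k * h) = 0) :
    Δ_[h] ^[n] f i = f (i + n * h) := by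
  rw [fwdDiff_iter_eq_single le_rfl fun k hk hkn => hf k (lt_of_le_of_ne hk hkn)]
  simp

lemma eq_of_fwdDiff_iter_eq {f : ℕ → G} (hf : ∀ k ≤ n, Δ_[h] ^[k] f i = Δ_[h] ^[k] f j) :
    f (i + n * h) = f (j + n * h) := by
  simp only [← smul_eq_mul, shift_eq_sum_fwdDiff_iter h f n]
  refine Finset.sum_congr rfl fun k hk => ?_
  rw [hf k (Finset.mem_range_succ_iff.mp hk)]

lemma dvd_choose_of_fwdDiff_iter_eq_zero [IsDomain R] {p : ℕ} [CharP R p] {f : ℕ → R} {r : ℕ}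
    (hr : r ≤ n) (hfr : f (i + r * h) ≠ 0) (hf : ∀ k ≤ n, k ≠ r → f (i + k * h) = 0)
    (h0 : Δ_[h] ^[n] f i = 0) : p ∣ n.choose r := by
  rw [fwdDiff_iter_eq_single hr hf] at h0
  have hchoose := (mul_eq_zero.mp h0).resolve_right hfr
  exact (CharP.cast_eq_zero_iff R p _).mp
    ((mul_eq_zero.mp hchoose).resolve_left (pow_ne_zero _ (neg_ne_zero.mpr one_ne_zero)))

/-- The sequence of the sums of `f` over the windows `i, i + 1, …, i + q - 1`. -/
def blockSum (q : ℕ) (f : ℕ → G) (i : ℕ) : G := ∑ k ∈ Finset.range q, f (i + k)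

lemma blockSum_eq_zero {f : ℕ → G} {q : ℕ} (hf : ∀ k, i ≤ k → k < i + q → f k = 0) :
    blockSum q f i = 0 :=
  Finset.sum_eq_zero fun k hk => hf _ (by lia) (by have := Finset.mem_range.mp hk; lia)

lemma blockSum_eq_single {f : ℕ → G} {q a : ℕ} (hia : i ≤ a) (haq : a < i + q)
    (hf : ∀ k, i ≤ k → k < i + q → k ≠ a → f k = 0) : blockSum q f i = f a := by
  obtain ⟨r, rfl⟩ := Nat.exists_eq_add_of_le hia
  refine Finset.sum_eq_single_of_mem r (Finset.mem_range.mpr (by lia)) fun k hk hkr => ?_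
  exact hf _ (by lia) (by have := Finset.mem_range.mp hk; lia) (by lia)

lemma fwdDiff_blockSum (q : ℕ) (f : ℕ → G) : Δ_[1] (blockSum q f) = Δ_[q] f := by
  funext i
  have hshift : ∀ k, f (i + 1 + k) - f (i + k) = f (i + (k + 1)) - f (i + k) := fun k => by
    rw [add_right_comm, add_assoc]
  simp only [fwdDiff, blockSum, ← Finset.sum_sub_distrib, hshift]
  exact Finset.sum_range_sub (fun k => f (i + k)) q

lemma fwdDiff_iter_blockSum_succ (q n : ℕ) (f : ℕ → G) (i : ℕ) :
    Δ_[q] ^[n] (blockSum q f) (i + 1) =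
      Δ_[q] ^[n] (blockSum q f) i + Δ_[q] ^[n + 1] f i := by
  have hcomm : Function.Commute (fwdDiff (G := G) 1) (fwdDiff q) := fun g => by
    funext k
    simp only [fwdDiff, add_right_comm k 1 q]
    abel
  rw [Function.iterate_succ_apply, ← fwdDiff_blockSum, ← (hcomm.iterate_right n) (blockSum q f),
    fwdDiff, add_sub_cancel]

section Shift

open Polynomial

variable (R) in
/-- The shift operator `f ↦ f (· + 1)` on sequences; `Δ_[q]` is the value of `X ^ q - 1` at it. -/
def shift : Module.End R (ℕ → R) := LinearMap.funLeft R R (· + 1)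

lemma aeval_shift_X_pow (k : ℕ) (f : ℕ → R) (i : ℕ) :
    aeval (shift R) (X ^ k : R[X]) f i = f (i + k) := by
  induction k generalizing i with
  | zero => simp
  | succ k ih =>
    rw [pow_succ', map_mul, aeval_X, Module.End.mul_apply]
    exact (ih (i + 1)).trans (by rw [add_assoc, add_comm 1 k])

lemma aeval_shift_X_pow_sub_one_pow (q n : ℕ) (f : ℕ → R) :
    aeval (shift R) ((X ^ q - 1 : R[X]) ^ n) f = Δ_[q] ^[n] f := by
  induction n generalizing f with
  | zero => simp
  | succ n ih =>
    rw [pow_succ, map_mul, Module.End.mul_apply, Function.iterate_succ_apply, ← ih]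
    congr 1
    funext i
    simp [← aeval_shift_X_pow q f i, fwdDiff]

lemma aeval_shift_geom_sum (q : ℕ) (f : ℕ → R) :
    aeval (shift R) (∑ k ∈ Finset.range q, X ^ k : R[X]) f = blockSum q f := by
  funext i
  rw [map_sum, LinearMap.sum_apply, Finset.sum_apply]
  exact Finset.sum_congr rfl fun k _ => aeval_shift_X_pow k f i

lemma X_sub_one_pow_prime_pow_mul_sub_one (p : ℕ) [Fact p.Prime] [CharP R p] (h n : ℕ) :
    (X - 1 : R[X]) ^ ((n + 1) * p ^ h - 1) =
      (X ^ p ^ h - 1) ^ n * ∑ k ∈ Finset.range (p ^ h), X ^ k := by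
  have hpos : 0 < (n + 1) * p ^ h := Nat.mul_pos n.succ_pos (pow_pos (Fact.out : p.Prime).pos h)
  have hfrob : (X - 1 : R[X]) ^ p ^ h = X ^ p ^ h - 1 := by
    rw [sub_pow_expChar_pow (p := p), one_pow]
  have hmonic : (X - 1 : R[X]).Monic := by simpa using monic_X_sub_C (1 : R)
  refine hmonic.isRegular.right ?_
  dsimp only
  rw [← pow_succ, Nat.sub_add_cancel hpos, mul_assoc, geom_sum_mul, ← pow_succ, ← hfrob, ← pow_mul,
    mul_comm]

lemma fwdDiff_iter_prime_pow_mul_sub_one (p : ℕ) [Fact p.Prime] [CharP R p] (h n : ℕ)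
    (f : ℕ → R) :
    Δ_[1] ^[(n + 1) * p ^ h - 1] f = Δ_[p ^ h] ^[n] (blockSum (p ^ h) f) := by
  rw [← aeval_shift_X_pow_sub_one_pow, pow_one, X_sub_one_pow_prime_pow_mul_sub_one, map_mul,
    Module.End.mul_apply, aeval_shift_geom_sum, aeval_shift_X_pow_sub_one_pow]

end Shift

end ForwardDifferences

lemma choose_prime_pow_modEq (p : ℕ) [Fact p.Prime] (e u s : ℕ) (hs : s < p ^ e) :
    (p ^ e * u + s).choose (p ^ e) ≡ u [MOD p] := by
  have hp := (Fact.out : p.Prime)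
  induction e generalizing s with
  | zero =>
    obtain rfl : s = 0 := by simpa using hs
    simp [Nat.ModEq.refl]
  | succ e ih =>
    have hdiv : (p ^ (e + 1) * u + s) / p = p ^ e * u + s / p := by
      rw [show p ^ (e + 1) * u + s = s + p * (p ^ e * u) by ring, Nat.add_mul_div_left _ _ hp.pos,
        add_comm]
    have hlucas := Choose.choose_modEq_choose_mod_mul_choose_div_nat
      (n := p ^ (e + 1) * u + s) (k := p ^ (e + 1)) (p := p)
    rw [hdiv, pow_succ, Nat.mul_mod_left, Nat.mul_div_cancel _ hp.pos, Nat.choose_zero_right,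
      one_mul] at hlucas
    exact hlucas.trans (ih _ (Nat.div_lt_of_lt_mul (by rwa [pow_succ'] at hs)))

lemma le_of_dvd_choose (p : ℕ) [Fact p.Prime] {m R : ℕ} (hm : 1 ≤ m)
    (hdvd : ∀ r, 1 ≤ r → r < R → p ∣ (m + r - 1).choose r) : R ≤ m := by
  have hp := (Fact.out : p.Prime)
  obtain ⟨e, u, hu, rfl⟩ := Nat.exists_eq_pow_mul_and_not_dvd (by lia : m ≠ 0) p hp.ne_one
  have hpe : 0 < p ^ e := pow_pos hp.pos e
  have hle : p ^ e ≤ p ^ e * u :=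
    Nat.le_mul_of_pos_right _ (Nat.pos_of_ne_zero fun h0 => hu (h0 ▸ dvd_zero p))
  by_contra! hlt
  have hdvd_choose := hdvd (p ^ e) hpe (hle.trans_lt hlt)
  rw [Nat.add_sub_assoc hpe] at hdvd_choose
  exact hu (((choose_prime_pow_modEq p e u _ (by lia)).dvd_iff dvd_rfl).mp hdvd_choose)

lemma neg_one_pow_mul_prime_pow_sub_one {R : Type*} [CommRing R] (p : ℕ) [Fact p.Prime] [CharP R p]
    (h n : ℕ) : (-1 : R) ^ ((n + 1) * p ^ h - 1) = (-1) ^ n := by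
  have hpos : 0 < (n + 1) * p ^ h := Nat.mul_pos n.succ_pos (pow_pos (Fact.out : p.Prime).pos h)
  refine isUnit_one.neg.mul_right_cancel ?_
  rw [← pow_succ, Nat.sub_add_cancel hpos, ← pow_succ, mul_comm, pow_mul,
    neg_one_pow_char_pow]

lemma exists_last_before {P : ℕ → Prop} {a b : ℕ} (hab : a < b) (ha : P a) :
    ∃ c, a ≤ c ∧ c < b ∧ P c ∧ ∀ k, c < k → k < b → ¬ P k := by
  classical
  have hle := Nat.findGreatest_le (P := P) (b - 1)
  exact ⟨Nat.findGreatest P (b - 1), Nat.le_findGreatest (by lia) ha, by lia,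
    Nat.findGreatest_spec (m := a) (by lia) ha,
    fun k hk hkb => Nat.findGreatest_is_greatest hk (by lia)⟩

section CentralizerSequence

variable {K : Type*} [Field K] {f : ℕ → K} {p q : ℕ}

/-- The identities that the Jacobi identity imposes on the scalars `f k` in a rescaled basis
`v 1 = y, v 2, …` of `L` with `⁅x, v k⁆ = v (k + 1)` and `⁅y, v k⁆ = f k • v (k + 1)`. The value
`f 0` is irrelevant. -/
structure IsCentralizerSequence (f : ℕ → K) : Prop where
  one : f 1 = 0
  two : f 2 = 0
  rel : ∀ i j, 1 ≤ i →
    Δ_[1] ^[j] f i * (f (i + j + 1) - f (j + 1)) = Δ_[1] ^[j] f (i + 1) * (f i - f (j + 1))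
  antisymm : ∀ i j, (-1) ^ j * Δ_[1] ^[j] f (i + 1) + (-1) ^ i * Δ_[1] ^[i] f (j + 1) = 0

/-- The first nonzero term of the sequence `f`, from the index `1` on, is the one with index `n`. -/
structure IsFirstNonzero (f : ℕ → K) (n : ℕ) : Prop where
  one_le : 1 ≤ n
  ne_zero : f n ≠ 0
  eq_zero : ∀ k, 1 ≤ k → k < n → f k = 0

/-- The terms of `f` with indices `a` and `a + m` are consecutive nonzero terms. For the sequence of
an algebra of maximal class, the constituents after the first one correspond to such pairs. -/
structure IsGap (f : ℕ → K) (a m : ℕ) : Prop where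
  one_le_left : 1 ≤ a
  one_le : 1 ≤ m
  ne_zero : f a ≠ 0
  ne_zero' : f (a + m) ≠ 0
  eq_zero : ∀ k, 1 ≤ k → k < m → f (a + k) = 0

lemma exists_isFirstNonzero {k : ℕ} (hk : 1 ≤ k) (hfk : f k ≠ 0) : ∃ n, IsFirstNonzero f n := by
  classical
  obtain ⟨n, ⟨hn, hfn⟩, hmin⟩ := Nat.findX (p := fun k => 1 ≤ k ∧ f k ≠ 0) ⟨k, hk, hfk⟩
  exact ⟨n, hn, hfn, fun k hk hkn => not_not.mp fun hne => hmin k hkn ⟨hk, hne⟩⟩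

lemma IsFirstNonzero.le {n k : ℕ} (hn : IsFirstNonzero f n) (hk : 1 ≤ k) (hfk : f k ≠ 0) :
    n ≤ k :=
  not_lt.mp fun hlt => hfk (hn.eq_zero k hk hlt)

namespace IsCentralizerSequence

lemma fwdDiff_iter_self (hf : IsCentralizerSequence f) (h2 : (2 : K) ≠ 0) (j : ℕ) :
    Δ_[1] ^[j] f (j + 1) = 0 := by
  have hself : 2 * ((-1) ^ j * Δ_[1] ^[j] f (j + 1)) = 0 := by
    linear_combination hf.antisymm j j
  exact (mul_eq_zero.mp ((mul_eq_zero.mp hself).resolve_left h2)).resolve_left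
    (pow_ne_zero _ (neg_ne_zero.mpr one_ne_zero))

lemma exists_eq_two_mul (hf : IsCentralizerSequence f) (h2 : (2 : K) ≠ 0) {n : ℕ}
    (hn : IsFirstNonzero f n) : ∃ q, 2 ≤ q ∧ n = 2 * q := by
  have hn0 := hn.one_le
  have hn1 : n ≠ 1 := fun h => hn.ne_zero (h ▸ hf.one)
  have hn2 : n ≠ 2 := fun h => hn.ne_zero (h ▸ hf.two)
  rcases Nat.even_or_odd' n with ⟨j, hj | hj⟩
  · exact ⟨j, by lia, hj⟩
  · have hself := hf.fwdDiff_iter_self h2 j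
    rw [fwdDiff_iter_eq_last fun k hk => hn.eq_zero _ (by lia) (by lia),
      show j + 1 + j * 1 = n by lia] at hself
    exact absurd hself hn.ne_zero

lemma exists_isGap (hf : IsCentralizerSequence f) (hq : IsFirstNonzero f (2 * q)) {a : ℕ}
    (ha : 1 ≤ a) (hfa : f a ≠ 0) : ∃ m ≤ 2 * q, IsGap f a m := by
  classical
  have hex : ∃ m, 1 ≤ m ∧ m ≤ 2 * q ∧ f (a + m) ≠ 0 := by
    by_contra! hno
    have hq0 := hq.one_le
    have hrel := hf.rel a (2 * q - 1) ha
    rw [fwdDiff_iter_eq_first fun k hk hk0 => hno _ (by lia) (by lia),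
      fwdDiff_iter_eq_zero fun k hk => by
        rw [add_assoc]; exact hno _ (by lia) (by lia),
      add_assoc, Nat.sub_add_cancel hq0, hno _ hq0 le_rfl, zero_mul, zero_sub] at hrel
    exact mul_ne_zero (mul_ne_zero (pow_ne_zero _ (neg_ne_zero.mpr one_ne_zero)) hfa)
      (neg_ne_zero.mpr hq.ne_zero) hrel
  obtain ⟨m, ⟨hm, hmq, hfm⟩, hmin⟩ := Nat.findX hex
  refine ⟨m, hmq, ha, hm, hfa, hfm, fun k hk hkm => ?_⟩
  by_contra hne
  exact hmin k hkm ⟨hk, by lia, hne⟩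

lemma dvd_choose (hf : IsCentralizerSequence f) [CharP K p]
    (hq : IsFirstNonzero f (2 * q)) {a m r : ℕ} (hgap : IsGap f a m) (hr : 1 ≤ r) (hra : r < a)
    (hmr : m + r < 2 * q) (hprev : ∀ k, 1 ≤ k → k ≤ r → f (a - k) = 0) :
    p ∣ (m + r - 1).choose r := by
  have hm := hgap.one_le
  have hrel := hf.rel (a - r) (m + r - 1) (by lia)
  rw [hprev r hr le_rfl, Nat.sub_add_cancel (by lia), hq.eq_zero _ (by lia) hmr,
    show a - r + (m + r - 1) + 1 = a + m by lia, sub_zero, sub_zero, mul_zero] at hrel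
  have ha : a - r + r * 1 = a := by lia
  refine dvd_choose_of_fwdDiff_iter_eq_zero (by lia) (ha.symm ▸ hgap.ne_zero) (fun k hk hkr => ?_)
    ((mul_eq_zero.mp hrel).resolve_right hgap.ne_zero')
  rcases lt_or_gt_of_ne hkr with hlt | hgt
  · rw [show a - r + k * 1 = a - (r - k) by lia]
    exact hprev _ (by lia) (by lia)
  · rw [show a - r + k * 1 = a + (k - r) by lia]
    exact hgap.eq_zero _ (by lia) (by lia)

lemma le_second_gap (hf : IsCentralizerSequence f) [Fact p.Prime] [CharP K p]
    (hq : IsFirstNonzero f (2 * q)) {m : ℕ} (hgap : IsGap f (2 * q) m) : q ≤ m := by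
  have hm := hgap.one_le
  have hle : 2 * q - m ≤ m := le_of_dvd_choose p hm fun r hr hlt =>
    hf.dvd_choose hq hgap hr (by lia) (by lia) fun k hk hkr => hq.eq_zero _ (by lia) (by lia)
  lia

lemma exists_eq_prime_pow (hf : IsCentralizerSequence f) [hp : Fact p.Prime] [CharP K p]
    (hp2 : p ≠ 2) (hq2 : 2 ≤ q) (hq : IsFirstNonzero f (2 * q)) :
    ∃ h, 1 ≤ h ∧ q = p ^ h := by
  have h2 : (2 : K) ≠ 0 := Ring.two_ne_zero (by rwa [ringChar.eq K p])
  obtain ⟨m, -, hgap⟩ := hf.exists_isGap hq hq.one_le hq.ne_zero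
  have hqm := hf.le_second_gap (p := p) hq hgap
  obtain ⟨e, u, hu, hqu⟩ := Nat.exists_eq_pow_mul_and_not_dvd (by lia : q ≠ 0) p hp.out.ne_one
  have hle : p ^ e ≤ q :=
    hqu ▸ Nat.le_mul_of_pos_right _ (Nat.pos_of_ne_zero fun h0 => hu (h0 ▸ dvd_zero p))
  rcases hle.eq_or_lt with heq | hlt
  · refine ⟨e, Nat.one_le_iff_ne_zero.mpr ?_, heq.symm⟩
    rintro rfl
    rw [pow_zero] at heq
    lia
  -- With `p ^ e = 2 * t + 1`, the vanishing of the difference of order `q + t` at `q + t + 1`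
  -- says that `(q + t).choose (p ^ e)`, which is `u` modulo `p`, is divisible by `p`.
  · obtain ⟨t, ht⟩ : Odd (p ^ e) := (hp.out.odd_of_ne_two hp2).pow
    have hidx : q + t + 1 + (q - t - 1) * 1 = 2 * q := by lia
    have hdvd : p ∣ (q + t).choose (q - t - 1) := by
      refine dvd_choose_of_fwdDiff_iter_eq_zero (by lia) (hidx.symm ▸ hq.ne_zero)
        (fun k hk hkr => ?_) (hf.fwdDiff_iter_self h2 (q + t))
      rcases lt_or_gt_of_ne hkr with hlt' | hgt
      · exact hq.eq_zero _ (by lia) (by lia)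
      · rw [show q + t + 1 + k * 1 = 2 * q + (k - (q - t - 1)) by lia]
        exact hgap.eq_zero _ (by lia) (by lia)
    have hmod := choose_prime_pow_modEq p e u t (by lia)
    rw [← hqu] at hmod
    rw [← Nat.choose_symm_of_eq_add (show q + t = p ^ e + (q - t - 1) by lia)] at hdvd
    exact absurd ((hmod.dvd_iff dvd_rfl).mp hdvd) hu

lemma le_gap (hf : IsCentralizerSequence f) [Fact p.Prime] [CharP K p]
    (hq : IsFirstNonzero f (2 * q)) {a b : ℕ} (ha : 1 ≤ a) (hab : a < b) (hfa : f a ≠ 0)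
    (hfb : f b ≠ 0) : q ≤ b - a := by
  induction b using Nat.strong_induction_on generalizing a with
  | _ b ih =>
    obtain ⟨c, hac, hcb, hfc, hlast⟩ := exists_last_before (P := fun k => f k ≠ 0) hab hfa
    have hc : 2 * q ≤ c := hq.le (by lia) hfc
    obtain ⟨m, rfl⟩ := Nat.exists_eq_add_of_lt hcb
    have hgap : IsGap f c (m + 1) := ⟨by lia, by lia, hfc, hfb, fun k hk hkm =>
      not_not.mp (hlast _ (by lia) (by lia))⟩
    have hprev : ∀ k, 1 ≤ k → k < q → f (c - k) = 0 := fun k hk hkq => by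
      by_contra hne
      have := ih c (by lia) (a := c - k) (by lia) (by lia) hne hfc
      lia
    by_contra! hlt
    have hqm : q ≤ m + 1 := le_of_dvd_choose p (by lia) fun s hs hsq =>
      hf.dvd_choose hq hgap hs (by lia) (by lia) fun k hk hks => hprev k hk (by lia)
    lia

lemma rel_prime_pow (hf : IsCentralizerSequence f) [Fact p.Prime] [CharP K p] (h n : ℕ) {i : ℕ}
    (hi : 1 ≤ i) :
    Δ_[p ^ h] ^[n] (blockSum (p ^ h) f) i *
        (f (i + (n + 1) * p ^ h) - f ((n + 1) * p ^ h)) =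
      Δ_[p ^ h] ^[n] (blockSum (p ^ h) f) (i + 1) * (f i - f ((n + 1) * p ^ h)) := by
  have hpos : 0 < (n + 1) * p ^ h := Nat.mul_pos n.succ_pos (pow_pos (Fact.out : p.Prime).pos h)
  have hrel := hf.rel i ((n + 1) * p ^ h - 1) hi
  rwa [fwdDiff_iter_prime_pow_mul_sub_one, add_assoc, Nat.sub_add_cancel hpos] at hrel

lemma antisymm_prime_pow (hf : IsCentralizerSequence f) [Fact p.Prime] [CharP K p] (h n m : ℕ) :
    (-1) ^ n * Δ_[p ^ h] ^[n] (blockSum (p ^ h) f) ((m + 1) * p ^ h) +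
      (-1) ^ m * Δ_[p ^ h] ^[m] (blockSum (p ^ h) f) ((n + 1) * p ^ h) = 0 := by
  have hpos : ∀ n, 0 < (n + 1) * p ^ h := fun n =>
    Nat.mul_pos n.succ_pos (pow_pos (Fact.out : p.Prime).pos h)
  have hantisymm := hf.antisymm ((m + 1) * p ^ h - 1) ((n + 1) * p ^ h - 1)
  rwa [fwdDiff_iter_prime_pow_mul_sub_one, fwdDiff_iter_prime_pow_mul_sub_one,
    Nat.sub_add_cancel (hpos n), Nat.sub_add_cancel (hpos m), neg_one_pow_mul_prime_pow_sub_one,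
    neg_one_pow_mul_prime_pow_sub_one] at hantisymm

end IsCentralizerSequence

end CentralizerSequence

section BlockSequence

variable {K : Type*} [Field K] {f : ℕ → K} {p q : ℕ}

/-- The identities of a centralizer sequence whose first nonzero term has index `2 * q`, with `q` a
power of the characteristic: iterated differences of step `1` have become iterated differences of
step `q` of the sums over windows of length `q`. -/
structure IsBlockSequence (f : ℕ → K) (q : ℕ) : Prop where
  two_le : 2 ≤ q
  first : IsFirstNonzero f (2 * q)
  exists_isGap : ∀ a, 1 ≤ a → f a ≠ 0 → ∃ m ≤ 2 * q, IsGap f a m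
  le_gap : ∀ a b, 1 ≤ a → a < b → f a ≠ 0 → f b ≠ 0 → q ≤ b - a
  rel : ∀ n i, 1 ≤ i →
    Δ_[q] ^[n] (blockSum q f) i * (f (i + (n + 1) * q) - f ((n + 1) * q)) =
      Δ_[q] ^[n] (blockSum q f) (i + 1) * (f i - f ((n + 1) * q))
  antisymm : ∀ n m, (-1) ^ n * Δ_[q] ^[n] (blockSum q f) ((m + 1) * q) +
    (-1) ^ m * Δ_[q] ^[m] (blockSum q f) ((n + 1) * q) = 0
  fwdDiff_one : ∀ n, (-1) ^ n * Δ_[q] ^[n] (blockSum q f) 1 = -f ((n + 1) * q)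

lemma IsCentralizerSequence.exists_isBlockSequence (hf : IsCentralizerSequence f)
    [hp : Fact p.Prime] [CharP K p] (hp2 : p ≠ 2) {k : ℕ} (hk : 1 ≤ k) (hfk : f k ≠ 0) :
    ∃ h, 1 ≤ h ∧ IsBlockSequence f (p ^ h) := by
  have h2 : (2 : K) ≠ 0 := Ring.two_ne_zero (by rwa [ringChar.eq K p])
  obtain ⟨n, hn⟩ := exists_isFirstNonzero hk hfk
  obtain ⟨q, hq2, rfl⟩ := hf.exists_eq_two_mul h2 hn
  obtain ⟨h, hh, rfl⟩ := hf.exists_eq_prime_pow hp2 hq2 hn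
  refine ⟨h, hh, hq2, hn, fun a => hf.exists_isGap hn, fun a b => hf.le_gap (p := p) hn,
    fun n i => hf.rel_prime_pow h n, hf.antisymm_prime_pow h, fun n => ?_⟩
  have hantisymm := hf.antisymm 0 ((n + 1) * p ^ h - 1)
  have hpos : 0 < (n + 1) * p ^ h := Nat.mul_pos n.succ_pos (by lia)
  rw [fwdDiff_iter_prime_pow_mul_sub_one, neg_one_pow_mul_prime_pow_sub_one,
    Nat.sub_add_cancel hpos, zero_add] at hantisymm
  simpa using eq_neg_of_add_eq_zero_left hantisymm

namespace IsBlockSequence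

lemma eq_of_ne_zero (hf : IsBlockSequence f q) {a b : ℕ} (ha : 1 ≤ a) (hb : 1 ≤ b)
    (hab : a < b + q) (hba : b < a + q) (hfa : f a ≠ 0) (hfb : f b ≠ 0) : a = b := by
  rcases lt_trichotomy a b with hlt | heq | hgt
  · have := hf.le_gap a b ha hlt hfa hfb
    lia
  · exact heq
  · have := hf.le_gap b a hb hgt hfb hfa
    lia

lemma blockSum_eq_of_ne_zero (hf : IsBlockSequence f q) {a i : ℕ} (hi : 1 ≤ i) (hia : i ≤ a)
    (haq : a < i + q) (hfa : f a ≠ 0) : blockSum q f i = f a :=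
  blockSum_eq_single hia haq fun k hik hkq hka => by
    by_contra hne
    exact hka (hf.eq_of_ne_zero (by lia) (by lia) (by lia) (by lia) hne hfa)

lemma blockSum_add_eq (hf : IsBlockSequence f q) {c M : ℕ} (hc : 1 ≤ c) (hfc : f c ≠ 0)
    (hzero : ∀ N, 1 ≤ N → N ≤ M + 1 → f (c + N * q) = 0) :
    blockSum q f (c + 1 + M * q) = blockSum q f (1 + M * q) := by
  refine eq_of_fwdDiff_iter_eq fun n hn => ?_
  have hrel := hf.rel n c hc
  rw [hzero (n + 1) (by lia) (by lia)] at hrel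
  have hsucc := fwdDiff_iter_blockSum_succ q n f c
  rw [fwdDiff_iter_eq_first fun k hk hk1 => hzero k hk1 (by lia)] at hsucc
  have hsign : (-1 : K) ^ n * (-1) ^ n = 1 := by rw [← mul_pow, neg_one_mul, neg_neg, one_pow]
  have hc1 : Δ_[q] ^[n] (blockSum q f) (c + 1) = -(-1) ^ n * f ((n + 1) * q) :=
    mul_right_cancel₀ hfc (by linear_combination -hrel + f ((n + 1) * q) * hsucc)
  linear_combination hc1 - (-1) ^ n * hf.fwdDiff_one n + Δ_[q] ^[n] (blockSum q f) 1 * hsign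

/-- If the claim fails, compare the window containing `b` with its translate by the last bad
index `c`: both have the same sum by `blockSum_add_eq`, but the sum of the translate is `0` or the
ordinary value `f (2 * q)`. -/
lemma modEq_of_ne (hf : IsBlockSequence f q) {b : ℕ} (hb : f b ≠ 0) (hb' : f b ≠ f (2 * q))
    (hmin : ∀ k, 1 ≤ k → k < b → f k ≠ 0 → f k = f (2 * q))
    {a : ℕ} (ha : 1 ≤ a) (hab : a < b) (hfa : f a ≠ 0) : a ≡ b [MOD q] := by
  have hq := hf.two_le
  by_contra hmod
  obtain ⟨c, hac, hcb, ⟨hfc, hcmod⟩, hlast⟩ := exists_last_before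
    (P := fun k => f k ≠ 0 ∧ ¬ k ≡ b [MOD q]) hab ⟨hfa, hmod⟩
  have hc : 2 * q ≤ c := hf.first.le (by lia) hfc
  set M := (b - c) / q
  have hdiv : (b - c) % q + M * q = b - c := Nat.mod_add_div' _ _
  have hlt : (b - c) % q < q := Nat.mod_lt _ (by lia)
  have hpos : 0 < (b - c) % q := Nat.pos_of_ne_zero fun h0 =>
    hcmod ((Nat.modEq_iff_dvd' hcb.le).mpr (Nat.dvd_of_mod_eq_zero h0))
  have hzero : ∀ N, 1 ≤ N → N ≤ M + 1 → f (c + N * q) = 0 := by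
    intro N hN hNM
    by_contra hne
    have hle : N * q ≤ M * q + q := (Nat.mul_le_mul_right q hNM).trans_eq (Nat.succ_mul M q)
    have hge : q ≤ N * q := Nat.le_mul_of_pos_left q hN
    have hncong : ¬ c + N * q ≡ b [MOD q] := by simpa [Nat.ModEq] using hcmod
    rcases lt_or_ge (c + N * q) b with hlt' | hge'
    · exact hlast _ (by lia) hlt' ⟨hne, hncong⟩
    · have heq := hf.eq_of_ne_zero (by lia) (by lia) (by lia) (by lia) hne hb
      exact hncong (heq ▸ Nat.ModEq.refl _)
  have hsum : f b = blockSum q f (1 + M * q) := by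
    rw [← hf.blockSum_add_eq (by lia) hfc hzero,
      hf.blockSum_eq_of_ne_zero (by lia) (by lia) (by lia) hb]
  by_cases hall : ∀ k, 1 + M * q ≤ k → k < 1 + M * q + q → f k = 0
  · exact hb (hsum.trans (blockSum_eq_zero hall))
  · push Not at hall
    obtain ⟨k, hk, hkq, hfk⟩ := hall
    rw [hf.blockSum_eq_of_ne_zero (by lia) hk hkq hfk] at hsum
    exact hb' (hsum.trans (hmin k (by lia) (by lia) hfk))

end IsBlockSequence

/-- The first nonzero term of `f` whose index is not a multiple of `q` has index `b`, which lies
between `(γ + 1) * q` and `(γ + 2) * q`, and the term `f ((γ + 1) * q)` vanishes. -/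
structure IsFirstNonmultiple (f : ℕ → K) (q γ b : ℕ) : Prop where
  ne_zero : f b ≠ 0
  lt : (γ + 1) * q < b
  lt_add : b < (γ + 1) * q + q
  dvd : ∀ k, 1 ≤ k → k < b → f k ≠ 0 → q ∣ k
  eq_zero : f ((γ + 1) * q) = 0

namespace IsBlockSequence

lemma exists_isFirstNonmultiple (hf : IsBlockSequence f q) {b : ℕ} (hb : 1 ≤ b) (hfb : f b ≠ 0)
    (hndvd : ¬ q ∣ b) (hdvd : ∀ k, 1 ≤ k → k < b → f k ≠ 0 → q ∣ k) :
    ∃ γ, IsFirstNonmultiple f q γ b := by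
  have hb2 : 2 * q < b := lt_of_le_of_ne (hf.first.le hb hfb) fun heq =>
    hndvd (heq ▸ Dvd.intro_left 2 rfl)
  obtain ⟨c, hc, hcb, hfc, hlast⟩ :=
    exists_last_before (P := fun k => f k ≠ 0) hb2 hf.first.ne_zero
  have hq := hf.two_le
  obtain ⟨γ, rfl⟩ := exists_eq_mul_left_of_dvd (hdvd c (by lia) hcb hfc)
  have hle := hf.le_gap _ b (by lia) hcb hfc hfb
  obtain ⟨m, hm, hgap⟩ := hf.exists_isGap _ (by lia) hfc
  have hge : b ≤ γ * q + m := by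
    by_contra! hlt
    exact hlast _ (by have := hgap.one_le; lia) hlt hgap.ne_zero'
  have hne : ∀ t, b ≠ t * q := fun t heq => hndvd (heq ▸ Dvd.intro_left t rfl)
  have hne1 := hne (γ + 1)
  have hne2 := hne (γ + 2)
  rw [add_mul] at hne1 hne2
  refine ⟨γ, hfb, by lia, by lia, hdvd, not_not.mp (hlast _ (by lia) (by lia))⟩

end IsBlockSequence

namespace IsFirstNonmultiple

variable {γ b : ℕ}

lemma not_dvd (hb : IsFirstNonmultiple f q γ b) : ¬ q ∣ b := by
  rintro ⟨t, rfl⟩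
  have hlt : γ + 1 < t := lt_of_mul_lt_mul_left (a := q) (by have := hb.lt; lia) q.zero_le
  have hlt' : t < γ + 2 := lt_of_mul_lt_mul_left (a := q) (by have := hb.lt_add; lia) q.zero_le
  lia

lemma eq_zero_of_add (hb : IsFirstNonmultiple f q γ b) {k t : ℕ} (hk : 1 ≤ k) (ht : 1 ≤ t)
    (hkt : k + t * q = b) : f k = 0 := by
  have hq : q ≠ 0 := by
    rintro rfl
    have := hb.lt
    have := hb.lt_add
    lia
  have htq : 0 < t * q := Nat.mul_pos ht (Nat.pos_of_ne_zero hq)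
  by_contra hne
  exact hb.not_dvd (hkt ▸ (hb.dvd k hk (by lia) hne).add (Dvd.intro_left t rfl))

lemma blockSum_eq_of_dvd (hb : IsFirstNonmultiple f q γ b) {i t : ℕ} (hi : 1 ≤ i)
    (hit : i ≤ t * q) (htq : t * q < i + q) (hib : i + q ≤ b) : blockSum q f i = f (t * q) :=
  blockSum_eq_single hit htq fun k hik hkq hkt => by
    by_contra hne
    obtain ⟨u, rfl⟩ := exists_eq_mul_left_of_dvd (hb.dvd k (by lia) (by lia) hne)
    have hut : u < t + 1 := lt_of_mul_lt_mul_right (a := q) (by lia) q.zero_le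
    have htu : t < u + 1 := lt_of_mul_lt_mul_right (a := q) (by lia) q.zero_le
    exact hkt (by rw [show u = t by lia])

lemma fwdDiff_iter_of_add_eq (hf : IsBlockSequence f q) (hb : IsFirstNonmultiple f q γ b)
    {n i : ℕ} (hi : 1 ≤ i) (hib : i + (n + 1) * q = b) :
    Δ_[q] ^[n] (blockSum q f) i = -f ((n + 1) * q) := by
  have hzero : ∀ l < n + 1, f (i + l * q) = 0 := fun l hl =>
    hb.eq_zero_of_add (t := n + 1 - l) (by lia) (by lia) (by
      rw [add_assoc, ← add_mul, Nat.add_sub_cancel' hl.le, hib])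
  have hsucc := fwdDiff_iter_blockSum_succ q n f i
  rw [fwdDiff_iter_eq_last hzero, hib] at hsucc
  have hrel := hf.rel n i hi
  have hfi : f i = 0 := by simpa using hzero 0 n.succ_pos
  rw [hib, hfi] at hrel
  exact mul_right_cancel₀ hb.ne_zero (by linear_combination hrel - f ((n + 1) * q) * hsucc)

/-- Move the first window back by `(γ + 2) * q - b`, so that the last one ends just before `b`: this
changes only the sum over the last window, which contains `b` before and no nonzero term after. -/
lemma fwdDiff_iter_mul (hf : IsBlockSequence f q) (hb : IsFirstNonmultiple f q γ b) {n m : ℕ}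
    (hnm : n + m = γ) :
    Δ_[q] ^[n] (blockSum q f) ((m + 1) * q) = f b - f ((n + 1) * q) := by
  have hq := hf.two_le
  have hlt := hb.lt
  have hlt' := hb.lt_add
  have hsplit : (m + 1) * q + n * q = (γ + 1) * q := by rw [← hnm]; ring
  obtain ⟨i, hi⟩ : ∃ i, i + (n + 1) * q = b := ⟨b - (n + 1) * q, by lia⟩
  have hblocks : ∀ l < n, blockSum q f ((m + 1) * q + l * q) = blockSum q f (i + l * q) := by
    intro l hl
    have hle : (l + 1) * q ≤ n * q := Nat.mul_le_mul_right q hl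
    rw [add_mul l 1] at hle
    have hmul : (m + 1 + l) * q = (m + 1) * q + l * q := add_mul _ _ _
    rw [hb.blockSum_eq_of_dvd (i := i + l * q) (t := m + 1 + l) (by lia) (by lia) (by lia)
      (by lia), ← hmul]
    exact hb.blockSum_eq_of_dvd (by lia) le_rfl (by lia) (by lia)
  have hlast : blockSum q f ((m + 1) * q + n * q) = f b :=
    hf.blockSum_eq_of_ne_zero (by lia) (by lia) (by lia) hb.ne_zero
  have hlast' : blockSum q f (i + n * q) = 0 := by
    rw [hb.blockSum_eq_of_dvd (t := γ + 1) (by lia) (by lia) (by lia) (by lia), hb.eq_zero]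
  have hsub := fwdDiff_iter_sub_fwdDiff_iter hblocks
  rw [hlast, hlast', fwdDiff_iter_of_add_eq hf hb (by lia) hi] at hsub
  linear_combination hsub

lemma apply_mul_palindromic (hf : IsBlockSequence f q) (hb : IsFirstNonmultiple f q γ b) {n m : ℕ}
    (hnm : n + m = γ) : f ((n + 1) * q) = f ((m + 1) * q) := by
  have hanti : ∀ n m, n + m = γ →
      (-1) ^ n * (f b - f ((n + 1) * q)) + (-1) ^ m * (f b - f ((m + 1) * q)) = 0 :=
    fun n m hnm => by
      rw [← fwdDiff_iter_mul hf hb hnm, ← fwdDiff_iter_mul hf hb ((add_comm m n).trans hnm)]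
      exact hf.antisymm n m
  have hq := hf.two_le
  have hγ : (-1 : K) ^ γ = -1 := by
    have h0 := hanti 0 γ (zero_add γ)
    rw [hb.eq_zero, hf.first.eq_zero ((0 + 1) * q) (by lia) (by lia)] at h0
    exact mul_right_cancel₀ hb.ne_zero (by linear_combination h0)
  have hsign : (-1 : K) ^ n * (-1) ^ n = 1 := by rw [← mul_pow, neg_one_mul, neg_neg, one_pow]
  have hsign' : (-1 : K) ^ n * (-1) ^ m = -1 := by rw [← pow_add, hnm, hγ]
  linear_combination -(-1) ^ n * hanti n m hnm + (f b - f ((n + 1) * q)) * hsign +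
    (f b - f ((m + 1) * q)) * hsign'

lemma eq_zero_or_eq (hf : IsBlockSequence f q) (hb : IsFirstNonmultiple f q γ b) {n : ℕ}
    (hn : (n + 1) * q < b) : f ((n + 1) * q) = 0 ∨ f ((n + 1) * q) = f b := by
  have hq := hf.two_le
  have hlt := hb.lt
  have hlt' := hb.lt_add
  have hnγ : n + 1 < γ + 2 := lt_of_mul_lt_mul_right (a := q) (by lia) q.zero_le
  obtain ⟨m, hnm⟩ : ∃ m, n + m = γ := ⟨γ - n, by lia⟩
  have hidx : (m + 1) * q + (n + 1) * q = (γ + 1) * q + q := by rw [← hnm]; ring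
  have hzero : f ((γ + 1) * q + q) = 0 := by
    by_contra hne
    have := hf.eq_of_ne_zero (by lia) (by lia) (by lia) (by lia) hne hb.ne_zero
    lia
  have hpos : 1 ≤ (m + 1) * q := Nat.mul_pos m.succ_pos (by lia)
  have hrel := hf.rel n _ hpos
  rw [hidx, hzero, ← apply_mul_palindromic hf hb hnm, sub_self, mul_zero,
    fwdDiff_iter_mul hf hb hnm, zero_sub, mul_neg, neg_eq_zero, mul_eq_zero] at hrel
  exact hrel.symm.imp_right fun h => (sub_eq_zero.mp h).symm

end IsFirstNonmultiple

namespace IsBlockSequence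

lemma eq_of_not_dvd (hf : IsBlockSequence f q) {c : ℕ} (hc : 1 ≤ c) (hfc : f c ≠ 0)
    (hndvd : ¬ q ∣ c) (hdvd : ∀ k, 1 ≤ k → k < c → f k ≠ 0 → q ∣ k) {k : ℕ} (hk : 1 ≤ k)
    (hkc : k < c) (hfk : f k ≠ 0) : f k = f c := by
  obtain ⟨γ, hγ⟩ := hf.exists_isFirstNonmultiple hc hfc hndvd hdvd
  obtain ⟨t, rfl⟩ := exists_eq_mul_left_of_dvd (hdvd k hk hkc hfk)
  obtain ⟨n, rfl⟩ := Nat.exists_eq_succ_of_ne_zero (by rintro rfl; lia : t ≠ 0)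
  exact (hγ.eq_zero_or_eq hf hkc).resolve_left hfk

theorem dvd_of_ne_zero (hf : IsBlockSequence f q)
    (hex : ∃ b, 1 ≤ b ∧ f b ≠ 0 ∧ f b ≠ f (2 * q)) {k : ℕ} (hk : 1 ≤ k) (hfk : f k ≠ 0) :
    q ∣ k := by
  classical
  obtain ⟨b, ⟨hb, hfb, hfb'⟩, hbmin⟩ := Nat.findX hex
  have hb2 : 2 * q < b :=
    lt_of_le_of_ne (hf.first.le hb hfb) (by rintro rfl; exact hfb' rfl)
  have hmod : ∀ a, 1 ≤ a → a < b → f a ≠ 0 → a ≡ b [MOD q] := fun a ha hab hfa =>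
    hf.modEq_of_ne hfb hfb' (fun k hk hkb hfk => not_not.mp fun hne => hbmin k hkb ⟨hk, hfk, hne⟩)
      ha hab hfa
  have hbdvd : q ∣ b :=
    ((hmod _ hf.first.one_le hb2 hf.first.ne_zero).dvd_iff dvd_rfl).mp (Dvd.intro_left 2 rfl)
  by_contra hkd
  obtain ⟨c, ⟨hc, hfc, hcd⟩, hcmin⟩ :=
    Nat.findX (p := fun k => 1 ≤ k ∧ f k ≠ 0 ∧ ¬ q ∣ k) ⟨k, hk, hfk, hkd⟩
  have hdvd : ∀ k, 1 ≤ k → k < c → f k ≠ 0 → q ∣ k := fun k hk hkc hfk =>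
    not_not.mp fun hne => hcmin k hkc ⟨hk, hfk, hne⟩
  have hbc : b < c := by
    rcases lt_trichotomy b c with hlt | rfl | hgt
    · exact hlt
    · exact absurd hbdvd hcd
    · exact absurd (((hmod c hc hgt hfc).dvd_iff dvd_rfl).mpr hbdvd) hcd
  exact hfb' ((hf.eq_of_not_dvd hc hfc hcd hdvd hb hbc hfb).trans
    (hf.eq_of_not_dvd hc hfc hcd hdvd hf.first.one_le (hb2.trans hbc) hf.first.ne_zero).symm)

theorem gap_eq (hf : IsBlockSequence f q) (hex : ∃ b, 1 ≤ b ∧ f b ≠ 0 ∧ f b ≠ f (2 * q)) {a m : ℕ}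
    (hgap : IsGap f a m) : m = q ∨ m = 2 * q := by
  have hm := hgap.one_le
  obtain ⟨u, rfl⟩ : q ∣ m :=
    (Nat.dvd_add_right (hf.dvd_of_ne_zero hex hgap.one_le_left hgap.ne_zero)).mp
      (hf.dvd_of_ne_zero hex (by lia) hgap.ne_zero')
  obtain ⟨m', hm', hgap'⟩ := hf.exists_isGap a hgap.one_le_left hgap.ne_zero
  have hle : q * u ≤ 2 * q := by
    by_contra! hlt
    exact hgap'.ne_zero' (hgap.eq_zero m' hgap'.one_le (by lia))
  have hu : u ≤ 2 := Nat.le_of_mul_le_mul_right (by lia) (by have := hf.two_le; lia : 0 < q)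
  interval_cases u <;> lia

end IsBlockSequence

end BlockSequence

section Generation

variable {R L : Type*} [CommRing R] [LieRing L] [LieAlgebra R L] {s : Set L}

lemma lie_mem_of_lieSpan_eq_top {M : Type*} [AddCommGroup M] [Module R M] [LieRingModule L M]
    [LieModule R L M] (hs : LieSubalgebra.lieSpan R L s = ⊤) {P : Submodule R M}
    (h : ∀ a ∈ s, ∀ m ∈ P, ⁅a, m⁆ ∈ P) (a : L) {m : M} (hm : m ∈ P) : ⁅a, m⁆ ∈ P := by
  have ha : a ∈ LieSubalgebra.lieSpan R L s := hs ▸ LieSubalgebra.mem_top a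
  induction ha using LieSubalgebra.lieSpan_induction generalizing m with
  | mem a ha => exact h a ha m hm
  | zero => rw [zero_lie]; exact zero_mem P
  | add a b _ _ ha hb => rw [add_lie]; exact add_mem (ha hm) (hb hm)
  | smul c a _ ha => rw [smul_lie]; exact P.smul_mem c (ha hm)
  | lie a b _ _ ha hb => rw [lie_lie]; exact sub_mem (ha (hb hm)) (hb (ha hm))

lemma eq_top_of_lieSpan_eq_top (hs : LieSubalgebra.lieSpan R L s = ⊤) {P : Submodule R L}
    (hsP : s ⊆ P) (h : ∀ a ∈ s, ∀ b ∈ P, ⁅a, b⁆ ∈ P) : P = ⊤ := by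
  let H : LieSubalgebra R L :=
    { P with lie_mem' := fun {a _} _ hb => lie_mem_of_lieSpan_eq_top hs h a hb }
  have hH : H = ⊤ := top_le_iff.mp (hs ▸ LieSubalgebra.lieSpan_le.mpr hsP)
  exact congrArg LieSubalgebra.toSubmodule hH

lemma map_lie_of_lieSpan_eq_top {L' : Type*} [LieRing L'] [LieAlgebra R L']
    (hs : LieSubalgebra.lieSpan R L s = ⊤) (φ : L →ₗ[R] L')
    (h : ∀ a ∈ s, ∀ b, φ ⁅a, b⁆ = ⁅φ a, φ b⁆) (a b : L) : φ ⁅a, b⁆ = ⁅φ a, φ b⁆ := by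
  have ha : a ∈ LieSubalgebra.lieSpan R L s := hs ▸ LieSubalgebra.mem_top a
  induction ha using LieSubalgebra.lieSpan_induction generalizing b with
  | mem a ha => exact h a ha b
  | zero => rw [zero_lie, map_zero, zero_lie]
  | add a c _ _ ha hc => rw [add_lie, map_add, map_add, add_lie, ha, hc]
  | smul r a _ ha => rw [smul_lie, map_smul, map_smul, smul_lie, ha]
  | lie a c _ _ ha hc => rw [lie_lie, map_sub, ha, hc, ha, hc, ha, lie_lie]

end Generation

section StandardBasis

variable {F L : Type*} [Field F] [LieRing L] [LieAlgebra F L]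

/-- A basis `x, v 1 = y, v 2, v 3, …` of an algebra of maximal class adapted to its grading, with
`y ∈ C_2` and with structure constants `a k`, `b k` for the actions of `x` and `y`. The basis is
normalized so that `v (k + 1)` is `⁅x, v k⁆`, or `⁅y, v k⁆` if the former is zero. -/
structure IsStandardBasis (𝒜 : ℕ → Submodule F L) (x y : L) (v : ℕ → L) (a b : ℕ → F) : Prop where
  linearIndependent : LinearIndependent F ![x, y]
  zero_eq_bot : 𝒜 0 = ⊥
  span_one : 𝒜 1 = Submodule.span F {x, y}
  v_one : v 1 = y
  v_ne_zero : ∀ k, 1 ≤ k → v k ≠ 0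
  span : ∀ k, 2 ≤ k → 𝒜 k = Submodule.span F {v k}
  lie_x : ∀ k, 1 ≤ k → ⁅x, v k⁆ = a k • v (k + 1)
  lie_y : ∀ k, 1 ≤ k → ⁅y, v k⁆ = b k • v (k + 1)
  b_two : b 2 = 0
  normalized : ∀ k, 1 ≤ k → a k = 1 ∨ a k = 0 ∧ b k = 1

open Classical in
/-- The sequence `0, y, ⁅x, y⁆, …` in which every element is obtained from the preceding one by the
action of `x`, or by that of `y` if `x` annihilates it. -/
noncomputable def standardVec (x y : L) : ℕ → L
  | 0 => 0
  | 1 => y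
  | k + 2 => if ⁅x, standardVec x y (k + 1)⁆ = 0 then ⁅y, standardVec x y (k + 1)⁆
      else ⁅x, standardVec x y (k + 1)⁆

lemma standardVec_succ (x y : L) {k : ℕ} (hk : 1 ≤ k) :
    ⁅x, standardVec x y k⁆ ≠ 0 ∧ ⁅x, standardVec x y k⁆ = standardVec x y (k + 1) ∨
      ⁅x, standardVec x y k⁆ = 0 ∧ ⁅y, standardVec x y k⁆ = standardVec x y (k + 1) := by
  obtain ⟨k, rfl⟩ := Nat.exists_eq_add_of_le' hk
  rw [standardVec]
  split_ifs with h
  · exact Or.inr ⟨h, rfl⟩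
  · exact Or.inl ⟨h, rfl⟩

namespace IsMaximalClass

variable {𝒜 : ℕ → Submodule F L} [GradedLieAlgebra 𝒜]

lemma finite_component (hL : IsMaximalClass 𝒜) (i : ℕ) : Module.Finite F (𝒜 i) := by
  rw [← Module.rank_lt_aleph0_iff]
  match i with
  | 0 => rw [hL.zero_eq_bot, rank_bot]; exact Cardinal.aleph0_pos
  | 1 => rw [hL.rank_one]; exact Cardinal.ofNat_lt_aleph0
  | i + 2 => exact (hL.rank_le_one _ (by lia)).trans_lt Cardinal.one_lt_aleph0

lemma span_eq (hL : IsMaximalClass 𝒜) {k : ℕ} (hk : 2 ≤ k) {w : L} (hw : w ∈ 𝒜 k)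
    (hne : w ≠ 0) : 𝒜 k = Submodule.span F {w} := by
  obtain ⟨u, -, hu⟩ := (rank_submodule_le_one_iff (𝒜 k)).mp (hL.rank_le_one k hk)
  obtain ⟨c, rfl⟩ := Submodule.mem_span_singleton.mp (hu hw)
  have hc : c ≠ 0 := fun h => hne (by rw [h, zero_smul])
  refine le_antisymm (hu.trans ?_) ((Submodule.span_singleton_le_iff_mem _ _).mpr hw)
  rw [Submodule.span_singleton_smul_eq (isUnit_iff_ne_zero.mpr hc)]

lemma iSup_eq_top_of_lie_eq_zero (hL : IsMaximalClass 𝒜) {k : ℕ} (hk : 1 ≤ k)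
    (hzero : ∀ u ∈ 𝒜 1, ∀ w ∈ 𝒜 k, ⁅u, w⁆ = 0) : ⨆ i : Fin (k + 1), 𝒜 i = ⊤ := by
  have hle : ∀ i ≤ k, 𝒜 i ≤ ⨆ i : Fin (k + 1), 𝒜 i := fun i hi =>
    le_iSup (fun j : Fin (k + 1) => 𝒜 j) ⟨i, by lia⟩
  refine eq_top_of_lieSpan_eq_top hL.generated (hle 1 hk) fun a ha b hb => ?_
  induction hb using Submodule.iSup_induction' with
  | zero => rw [lie_zero]; exact zero_mem _
  | add y z _ _ hy hz => rw [lie_add]; exact add_mem hy hz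
  | mem i w hw =>
    rcases (show (i : ℕ) ≤ k by lia).eq_or_lt with heq | hlt
    · rw [hzero a ha w (heq ▸ hw)]
      exact zero_mem _
    · exact hle (1 + i) (by lia) (SetLike.GradedBracket.bracket_mem ha hw)

lemma exists_lie_ne_zero (hL : IsMaximalClass 𝒜) (hinf : ¬ Module.Finite F L) {k : ℕ}
    (hk : 1 ≤ k) : ∃ u ∈ 𝒜 1, ∃ w ∈ 𝒜 k, ⁅u, w⁆ ≠ 0 := by
  by_contra! hzero
  have hfin : ∀ i : Fin (k + 1), Module.Finite F (𝒜 i) := fun i => hL.finite_component i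
  have hsup : Module.Finite F (⨆ i : Fin (k + 1), 𝒜 i : Submodule F L) := Submodule.finite_iSup _
  rw [hL.iSup_eq_top_of_lie_eq_zero hk hzero] at hsup
  exact hinf (Module.Finite.equiv Submodule.topEquiv)

lemma exists_ne_zero_forall_lie_eq_zero (hL : IsMaximalClass 𝒜) {k : ℕ} (hk : 2 ≤ k) :
    ∃ y ∈ 𝒜 1, y ≠ 0 ∧ ∀ w ∈ 𝒜 k, ⁅y, w⁆ = 0 := by
  obtain ⟨u, hu, hspan⟩ := (rank_submodule_le_one_iff (𝒜 k)).mp (hL.rank_le_one k hk)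
  have hfin := hL.finite_component 1
  have hfin' := hL.finite_component (1 + k)
  let φ : 𝒜 1 →ₗ[F] 𝒜 (1 + k) := (LieAlgebra.ad F L u).restrict fun z hz => by
    rw [LieAlgebra.ad_apply, ← lie_skew]
    exact neg_mem (SetLike.GradedBracket.bracket_mem hz hu)
  have hrank : Module.finrank F (𝒜 (1 + k)) < Module.finrank F (𝒜 1) := by
    rw [Module.finrank_eq_of_rank_eq (n := 2) hL.rank_one]
    exact Nat.lt_succ_of_le
      (Module.finrank_le_of_rank_le (by simpa using hL.rank_le_one _ (by lia)))
  obtain ⟨y, hy, hy0⟩ := Submodule.exists_mem_ne_zero_of_ne_bot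
    (LinearMap.ker_ne_bot_of_finrank_lt (f := φ) hrank)
  have hyu : ⁅u, (y : L)⁆ = 0 := congrArg Subtype.val (LinearMap.mem_ker.mp hy)
  refine ⟨y, y.2, fun h => hy0 (Subtype.ext h), fun w hw => ?_⟩
  obtain ⟨c, rfl⟩ := Submodule.mem_span_singleton.mp (hspan hw)
  rw [lie_smul, ← lie_skew, hyu, neg_zero, smul_zero]

lemma exists_span_pair_eq (hL : IsMaximalClass 𝒜) {y : L} (hy : y ∈ 𝒜 1) (hy0 : y ≠ 0) :
    ∃ x, LinearIndependent F ![x, y] ∧ 𝒜 1 = Submodule.span F {x, y} := by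
  have hfin := hL.finite_component 1
  have hrank : Module.finrank F (𝒜 1) = 2 := Module.finrank_eq_of_rank_eq hL.rank_one
  obtain ⟨x, hx⟩ := exists_linearIndependent_pair_of_one_lt_finrank (R := F) (x := (⟨y, hy⟩ : 𝒜 1))
    (by lia) (fun h => hy0 (congrArg Subtype.val h))
  have hli : LinearIndependent F ![(x : L), y] := by
    rw [LinearIndependent.pair_symm_iff] at hx
    simpa [LinearIndependent.pair_iff, Subtype.ext_iff] using hx
  refine ⟨x, hli, (Submodule.eq_of_le_of_finrank_eq ?_ ?_).symm⟩
  · exact Submodule.span_le.mpr (Set.pair_subset x.2 hy)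
  · rw [hrank, ← Matrix.range_cons_cons_empty, finrank_span_eq_card hli, Fintype.card_fin]

lemma lie_ne_zero_or_lie_ne_zero (hL : IsMaximalClass 𝒜) (hinf : ¬ Module.Finite F L) {x y : L}
    (hspan : 𝒜 1 = Submodule.span F {x, y}) {k : ℕ} (hk : 1 ≤ k) {w : L} (hw : w ∈ 𝒜 k)
    (hne : w ≠ 0) (hone : k = 1 → w = y) : ⁅x, w⁆ ≠ 0 ∨ ⁅y, w⁆ ≠ 0 := by
  by_contra! hzero
  have hker : ∀ u ∈ 𝒜 1, ⁅u, w⁆ = 0 := by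
    intro u hu
    obtain ⟨α, β, rfl⟩ := Submodule.mem_span_pair.mp (hspan ▸ hu)
    rw [add_lie, smul_lie, smul_lie, hzero.1, hzero.2, smul_zero, smul_zero, add_zero]
  obtain ⟨u, hu, w', hw', huw⟩ := hL.exists_lie_ne_zero hinf hk
  rcases hk.eq_or_lt with rfl | hk2
  · obtain rfl := hone rfl
    obtain ⟨α, β, rfl⟩ := Submodule.mem_span_pair.mp (hspan ▸ hw')
    obtain ⟨α', β', rfl⟩ := Submodule.mem_span_pair.mp (hspan ▸ hu)
    have hyx : ⁅w, x⁆ = 0 := by rw [← lie_skew, hzero.1, neg_zero]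
    exact huw (by simp [hzero.1, hyx])
  · obtain ⟨c, rfl⟩ := Submodule.mem_span_singleton.mp (hL.span_eq hk2 hw hne ▸ hw')
    exact huw (by rw [lie_smul, hker u hu, smul_zero])

lemma standardVec_mem_and_ne_zero (hL : IsMaximalClass 𝒜) (hinf : ¬ Module.Finite F L) {x y : L}
    (hspan : 𝒜 1 = Submodule.span F {x, y}) (hy : y ≠ 0) {k : ℕ} (hk : 1 ≤ k) :
    standardVec x y k ∈ 𝒜 k ∧ standardVec x y k ≠ 0 := by
  have hx1 : x ∈ 𝒜 1 := hspan ▸ Submodule.mem_span_pair.mpr ⟨1, 0, by simp⟩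
  have hy1 : y ∈ 𝒜 1 := hspan ▸ Submodule.mem_span_pair.mpr ⟨0, 1, by simp⟩
  induction k, hk using Nat.le_induction with
  | base => exact ⟨hy1, hy⟩
  | succ k hk ih =>
    have hne := hL.lie_ne_zero_or_lie_ne_zero hinf hspan hk ih.1 ih.2 (by rintro rfl; rfl)
    rcases standardVec_succ x y hk with ⟨h0, h⟩ | ⟨h0, h⟩
    · refine ⟨?_, h ▸ h0⟩
      rw [← h, add_comm]
      exact SetLike.GradedBracket.bracket_mem hx1 ih.1
    · refine ⟨?_, h ▸ hne.resolve_left (not_not.mpr h0)⟩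
      rw [← h, add_comm]
      exact SetLike.GradedBracket.bracket_mem hy1 ih.1

lemma exists_standardVec_scalars (hL : IsMaximalClass 𝒜) (hinf : ¬ Module.Finite F L) {x y : L}
    (hspan : 𝒜 1 = Submodule.span F {x, y}) (hy : y ≠ 0) {k : ℕ} (hk : 1 ≤ k) :
    ∃ α β : F, ⁅x, standardVec x y k⁆ = α • standardVec x y (k + 1) ∧
      ⁅y, standardVec x y k⁆ = β • standardVec x y (k + 1) ∧ (α = 1 ∨ α = 0 ∧ β = 1) := by
  rcases standardVec_succ x y hk with ⟨-, h⟩ | ⟨h0, h⟩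
  · have hy1 : y ∈ 𝒜 1 := hspan ▸ Submodule.mem_span_pair.mpr ⟨0, 1, by simp⟩
    have hlie := SetLike.GradedBracket.bracket_mem hy1
      (hL.standardVec_mem_and_ne_zero hinf hspan hy hk).1
    obtain ⟨hv, hv0⟩ := hL.standardVec_mem_and_ne_zero hinf hspan hy (k := k + 1) (by lia)
    rw [add_comm, hL.span_eq (by lia) hv hv0] at hlie
    obtain ⟨β, hβ⟩ := Submodule.mem_span_singleton.mp hlie
    exact ⟨1, β, by rw [h, one_smul], hβ.symm, Or.inl rfl⟩
  · exact ⟨0, 1, by rw [h0, zero_smul], by rw [h, one_smul], Or.inr ⟨rfl, rfl⟩⟩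

theorem exists_isStandardBasis (hL : IsMaximalClass 𝒜) (hinf : ¬ Module.Finite F L) :
    ∃ x y v a b, IsStandardBasis 𝒜 x y v a b := by
  obtain ⟨y, hy, hy0, hy2⟩ := hL.exists_ne_zero_forall_lie_eq_zero le_rfl
  obtain ⟨x, hli, hspan⟩ := hL.exists_span_pair_eq hy hy0
  have hmem : ∀ k, 1 ≤ k → standardVec x y k ∈ 𝒜 k ∧ standardVec x y k ≠ 0 := fun k =>
    hL.standardVec_mem_and_ne_zero hinf hspan hy0
  choose! a b hx hy hab using fun k => hL.exists_standardVec_scalars hinf hspan hy0 (k := k)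
  refine ⟨x, y, standardVec x y, a, b, hli, hL.zero_eq_bot, hspan, rfl,
    fun k hk => (hmem k hk).2, fun k hk => ?_, hx, hy, ?_, hab⟩
  · exact hL.span_eq hk (hmem k (by lia)).1 (hmem k (by lia)).2
  · have hb2 := hy 2 (by lia)
    rw [hy2 _ (hmem 2 (by lia)).1] at hb2
    exact (smul_eq_zero.mp hb2.symm).resolve_right (hmem 3 (by lia)).2

end IsMaximalClass

namespace IsStandardBasis

variable {𝒜 : ℕ → Submodule F L} {x y : L} {v : ℕ → L} {a b : ℕ → F}

lemma x_mem (hb : IsStandardBasis 𝒜 x y v a b) : x ∈ 𝒜 1 := by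
  rw [hb.span_one]
  exact Submodule.subset_span (Set.mem_insert x {y})

lemma y_mem (hb : IsStandardBasis 𝒜 x y v a b) : y ∈ 𝒜 1 := by
  rw [hb.span_one]
  exact Submodule.subset_span (Set.mem_insert_of_mem x rfl)

lemma v_mem (hb : IsStandardBasis 𝒜 x y v a b) {k : ℕ} (hk : 1 ≤ k) : v k ∈ 𝒜 k := by
  rcases hk.eq_or_lt with rfl | hk2
  · rw [hb.v_one]
    exact hb.y_mem
  · rw [hb.span k hk2]
    exact Submodule.mem_span_singleton_self _

lemma ne_zero_or_ne_zero (hb : IsStandardBasis 𝒜 x y v a b) {k : ℕ} (hk : 1 ≤ k) :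
    a k ≠ 0 ∨ b k ≠ 0 :=
  (hb.normalized k hk).imp (fun h => h.trans_ne one_ne_zero)
    (fun h => h.2.trans_ne one_ne_zero)

lemma a_eq_one (hb : IsStandardBasis 𝒜 x y v a b) {k : ℕ} (hk : 1 ≤ k) (hbk : b k = 0) :
    a k = 1 :=
  (hb.normalized k hk).resolve_right fun h => zero_ne_one (hbk.symm.trans h.2)

lemma mem_twoStepCentralizer_iff (hb : IsStandardBasis 𝒜 x y v a b) {k : ℕ} (hk : 2 ≤ k)
    (α β : F) : α • x + β • y ∈ twoStepCentralizer 𝒜 k ↔ α * a k + β * b k = 0 := by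
  have hlie : ⁅v k, α • x + β • y⁆ = -((α * a k + β * b k) • v (k + 1)) := by
    rw [← lie_skew, add_lie, smul_lie, smul_lie, hb.lie_x k (by lia), hb.lie_y k (by lia),
      smul_smul, smul_smul, add_smul]
  constructor
  · rintro ⟨-, h⟩
    have hzero := h (v k) (hb.v_mem (by lia))
    rw [hlie, neg_eq_zero] at hzero
    exact (smul_eq_zero.mp hzero).resolve_right (hb.v_ne_zero _ (by lia))
  · intro h
    refine ⟨hb.span_one ▸ Submodule.mem_span_pair.mpr ⟨α, β, rfl⟩, fun w hw => ?_⟩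
    obtain ⟨c, rfl⟩ := Submodule.mem_span_singleton.mp (hb.span k hk ▸ hw)
    rw [smul_lie, hlie, h, zero_smul, neg_zero, smul_zero]

lemma x_notMem_twoStepCentralizer_two (hb : IsStandardBasis 𝒜 x y v a b) :
    x ∉ twoStepCentralizer 𝒜 2 := by
  have hx := hb.mem_twoStepCentralizer_iff le_rfl 1 0
  rw [one_smul, zero_smul, add_zero, one_mul, zero_mul, add_zero,
    hb.a_eq_one one_le_two hb.b_two] at hx
  exact fun h => one_ne_zero (hx.mp h)

lemma twoStepCentralizer_le (hb : IsStandardBasis 𝒜 x y v a b) {k l : ℕ} (hk : 2 ≤ k)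
    (hl : 2 ≤ l) (h : a k * b l = a l * b k) :
    twoStepCentralizer 𝒜 k ≤ twoStepCentralizer 𝒜 l := by
  intro u hu
  obtain ⟨α, β, rfl⟩ := Submodule.mem_span_pair.mp (hb.span_one ▸ hu.1)
  rw [hb.mem_twoStepCentralizer_iff hk] at hu
  rw [hb.mem_twoStepCentralizer_iff hl]
  rcases hb.ne_zero_or_ne_zero (show 1 ≤ k by lia) with hne | hne
  · exact (mul_eq_zero.mp (by linear_combination a l * hu + β * h :
      a k * (α * a l + β * b l) = 0)).resolve_left hne
  · exact (mul_eq_zero.mp (by linear_combination b l * hu - α * h :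
      b k * (α * a l + β * b l) = 0)).resolve_left hne

lemma twoStepCentralizer_eq_iff (hb : IsStandardBasis 𝒜 x y v a b) {k l : ℕ} (hk : 2 ≤ k)
    (hl : 2 ≤ l) :
    twoStepCentralizer 𝒜 k = twoStepCentralizer 𝒜 l ↔ a k * b l = a l * b k := by
  refine ⟨fun h => ?_, fun h => le_antisymm (hb.twoStepCentralizer_le hk hl h)
    (hb.twoStepCentralizer_le hl hk h.symm)⟩
  have hmem := (hb.mem_twoStepCentralizer_iff hk (b k) (-a k)).mpr (by ring)
  rw [h, hb.mem_twoStepCentralizer_iff hl] at hmem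
  linear_combination -hmem

end IsStandardBasis

end StandardBasis

section LieSequence

variable {K M : Type*} [LieRing M]

lemma lie_eq_fwdDiff_iter_smul [CommRing K] [LieAlgebra K M] {x : M} {w : ℕ → M} {f : ℕ → K}
    (hx : ∀ k, 1 ≤ k → ⁅x, w k⁆ = w (k + 1))
    (hy : ∀ k, 1 ≤ k → ⁅w 1, w k⁆ = f k • w (k + 1)) (j i : ℕ) (hi : 1 ≤ i) :
    ⁅w (j + 1), w i⁆ = ((-1) ^ j * Δ_[1] ^[j] f i) • w (i + j + 1) := by
  induction j generalizing i with
  | zero => simpa using hy i hi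
  | succ j ih =>
    rw [← hx (j + 1) (by lia), lie_lie, hx i hi, ih i hi, ih (i + 1) (by lia), lie_smul,
      hx _ (by lia), Function.iterate_succ_apply', fwdDiff, add_right_comm i 1 j, ← sub_smul,
      ← add_assoc i j 1]
    congr 1
    ring

lemma isCentralizerSequence_of_lie [Field K] [LieAlgebra K M] {x : M} {w : ℕ → M} {f : ℕ → K}
    (hne : ∀ k, 1 ≤ k → w k ≠ 0) (hx : ∀ k, 1 ≤ k → ⁅x, w k⁆ = w (k + 1))
    (hy : ∀ k, 1 ≤ k → ⁅w 1, w k⁆ = f k • w (k + 1)) (h2 : f 2 = 0) :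
    IsCentralizerSequence f where
  one := by
    have h := hy 1 le_rfl
    rw [lie_self] at h
    exact (smul_eq_zero.mp h.symm).resolve_right (hne _ (by lia))
  two := h2
  rel i j hi := by
    have hlie := lie_eq_fwdDiff_iter_smul hx hy
    have h := lie_lie (w 1) (w (j + 1)) (w i)
    rw [hy _ (by lia), smul_lie, hlie (j + 1) i hi, hlie j i hi, lie_smul, hy _ (by lia),
      hy i hi, lie_smul, hlie j (i + 1) (by lia), smul_smul, smul_smul, smul_smul,
      ← add_assoc i j 1, add_right_comm i 1 j, ← sub_smul] at h
    have hcoeff := smul_left_injective K (hne (i + j + 1 + 1) (by lia)) h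
    rw [Function.iterate_succ_apply', fwdDiff] at hcoeff
    have hsign : ((-1) ^ j * (-1) ^ j : K) = 1 := by rw [← mul_pow, neg_one_mul, neg_neg, one_pow]
    linear_combination -(-1) ^ j * hcoeff +
      (f (j + 1) * (Δ_[1] ^[j] f i - Δ_[1] ^[j] f (i + 1)) - Δ_[1] ^[j] f i * f (i + j + 1) +
        Δ_[1] ^[j] f (i + 1) * f i) * hsign
  antisymm i j := by
    have hlie := lie_eq_fwdDiff_iter_smul hx hy
    have h := lie_skew (w (j + 1)) (w (i + 1))
    rw [hlie j (i + 1) (by lia), hlie i (j + 1) (by lia), ← neg_smul,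
      show j + 1 + i + 1 = i + 1 + j + 1 by ring] at h
    linear_combination -smul_left_injective K (hne _ (by lia)) h

end LieSequence

section CentralizerSeq

variable {F : Type*} [Field F] {a b : ℕ → F}

/-- The structure constants of the action of `x + X y`, which lies outside all the two-step
centralizers, after extension of the scalars to the field of rational functions in `X`. -/
noncomputable def genericScalar (a b : ℕ → F) (k : ℕ) : RatFunc F :=
  RatFunc.C (a k) + RatFunc.X * RatFunc.C (b k)

/-- The structure constants of the action of `y`, for a basis rescaled so that those of the action
of `x + X y` become `1`. The `k`-th one determines the two-step centralizer `C_k`. -/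
noncomputable def centralizerSeq (a b : ℕ → F) (k : ℕ) : RatFunc F :=
  RatFunc.C (b k) / genericScalar a b k

lemma genericScalar_ne_zero {k : ℕ} (h : a k ≠ 0 ∨ b k ≠ 0) : genericScalar a b k ≠ 0 := by
  intro h0
  have hpoly : algebraMap F[X] (RatFunc F)
      (Polynomial.C (a k) + Polynomial.X * Polynomial.C (b k)) = 0 := by
    simpa only [genericScalar, map_add, map_mul, RatFunc.algebraMap_C, RatFunc.algebraMap_X]
      using h0
  rw [map_eq_zero_iff _ (RatFunc.algebraMap_injective F)] at hpoly
  rcases h with h | h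
  · exact h (by simpa using congrArg (Polynomial.coeff · 0) hpoly)
  · exact h (by simpa using congrArg (Polynomial.coeff · 1) hpoly)

lemma centralizerSeq_eq_iff {k l : ℕ} (hk : a k ≠ 0 ∨ b k ≠ 0) (hl : a l ≠ 0 ∨ b l ≠ 0) :
    centralizerSeq a b k = centralizerSeq a b l ↔ a k * b l = a l * b k := by
  rw [centralizerSeq, centralizerSeq,
    div_eq_div_iff (genericScalar_ne_zero hk) (genericScalar_ne_zero hl), genericScalar,
    genericScalar, ← (RatFunc.C_injective (K := F)).eq_iff (a := a k * b l), map_mul, map_mul]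
  constructor <;> intro h <;> linear_combination -h

lemma centralizerSeq_eq_zero_iff {k : ℕ} (hk : a k ≠ 0 ∨ b k ≠ 0) :
    centralizerSeq a b k = 0 ↔ b k = 0 := by
  simp [centralizerSeq, genericScalar_ne_zero hk]

lemma tmul_smul_eq_mul_C_tmul {L : Type*} [AddCommGroup L] [Module F L] (r : RatFunc F) (c : F)
    (u : L) : r ⊗ₜ[F] (c • u) = (r * RatFunc.C c) ⊗ₜ[F] u := by
  rw [TensorProduct.tmul_smul, TensorProduct.smul_tmul', mul_comm, RatFunc.smul_eq_C_mul]

end CentralizerSeq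

lemma exists_twoStepCentralizer_ne {F L : Type*} [Field F] [LieRing L] [LieAlgebra F L]
    {𝒜 : ℕ → Submodule F L} (hthree : 3 ≤ (twoStepCentralizers 𝒜).encard) (C D : Submodule F L) :
    ∃ k, 2 ≤ k ∧ twoStepCentralizer 𝒜 k ≠ C ∧ twoStepCentralizer 𝒜 k ≠ D := by
  by_contra! hno
  have hsub : twoStepCentralizers 𝒜 ⊆ {C, D} := by
    rintro _ ⟨k, hk, rfl⟩
    exact or_iff_not_imp_left.mpr (hno k hk)
  have hle := (hthree.trans (Set.encard_le_encard hsub)).trans (Set.encard_insert_le _ _)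
  rw [Set.encard_singleton] at hle
  exact absurd hle (by decide)

namespace IsStandardBasis

variable {F L : Type*} [Field F] [LieRing L] [LieAlgebra F L] {𝒜 : ℕ → Submodule F L} {x y : L}
  {v : ℕ → L} {a b : ℕ → F}

lemma isCentralizerSequence (hb : IsStandardBasis 𝒜 x y v a b) :
    IsCentralizerSequence (centralizerSeq a b) := by
  have hd : ∀ k, 1 ≤ k → genericScalar a b k ≠ 0 := fun k hk =>
    genericScalar_ne_zero (hb.ne_zero_or_ne_zero hk)
  let c : ℕ → RatFunc F := fun k => ∏ i ∈ Finset.Ico 1 k, genericScalar a b i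
  have hc : ∀ k, c k ≠ 0 := fun k => Finset.prod_ne_zero_iff.mpr fun i hi =>
    hd i (Finset.mem_Ico.mp hi).1
  have hcs : ∀ k, 1 ≤ k → c (k + 1) = c k * genericScalar a b k := fun k hk =>
    Finset.prod_Ico_succ_top hk _
  refine isCentralizerSequence_of_lie (x := 1 ⊗ₜ x + RatFunc.X ⊗ₜ y) (w := fun k => c k ⊗ₜ[F] v k)
    (fun k hk => ?_) (fun k hk => ?_) (fun k hk => ?_) ?_
  · have htmul : c k ⊗ₜ[F] v k = c k • (1 : RatFunc F) ⊗ₜ[F] v k := by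
      rw [TensorProduct.smul_tmul', smul_eq_mul, mul_one]
    rw [htmul]
    exact smul_ne_zero (hc k) ((map_ne_zero_iff (TensorProduct.mk F (RatFunc F) L 1)
      (Module.FaithfullyFlat.tensorProduct_mk_injective L)).mpr (hb.v_ne_zero k hk))
  · rw [add_lie, LieAlgebra.ExtendScalars.bracket_tmul, LieAlgebra.ExtendScalars.bracket_tmul,
      hb.lie_x k hk, hb.lie_y k hk, tmul_smul_eq_mul_C_tmul, tmul_smul_eq_mul_C_tmul,
      ← TensorProduct.add_tmul, hcs k hk, genericScalar]
    ring_nf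
  · have hc1 : c 1 = 1 := by simp only [c, Finset.Ico_self, Finset.prod_empty]
    rw [hc1, hb.v_one, LieAlgebra.ExtendScalars.bracket_tmul, hb.lie_y k hk,
      tmul_smul_eq_mul_C_tmul, TensorProduct.smul_tmul', hcs k hk, smul_eq_mul, one_mul,
      centralizerSeq, mul_left_comm, div_mul_cancel₀ _ (hd k hk)]
  · rw [centralizerSeq, hb.b_two, map_zero, zero_div]

lemma twoStepCentralizer_eq_iff_centralizerSeq_eq (hb : IsStandardBasis 𝒜 x y v a b) {k l : ℕ}
    (hk : 2 ≤ k) (hl : 2 ≤ l) :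
    twoStepCentralizer 𝒜 k = twoStepCentralizer 𝒜 l ↔
      centralizerSeq a b k = centralizerSeq a b l := by
  rw [hb.twoStepCentralizer_eq_iff hk hl, centralizerSeq_eq_iff (hb.ne_zero_or_ne_zero (by lia))
    (hb.ne_zero_or_ne_zero (by lia))]

lemma twoStepCentralizer_eq_two_iff (hb : IsStandardBasis 𝒜 x y v a b) {k : ℕ} (hk : 2 ≤ k) :
    twoStepCentralizer 𝒜 k = twoStepCentralizer 𝒜 2 ↔ centralizerSeq a b k = 0 := by
  rw [hb.twoStepCentralizer_eq_iff_centralizerSeq_eq hk le_rfl, hb.isCentralizerSequence.two]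

lemma secondOccursAt_iff (hb : IsStandardBasis 𝒜 x y v a b) {n : ℕ} :
    SecondOccursAt 𝒜 n ↔ IsFirstNonzero (centralizerSeq a b) n := by
  have hf := hb.isCentralizerSequence
  constructor
  · rintro ⟨hn, hne, heq⟩
    refine ⟨by lia, fun h => hne ((hb.twoStepCentralizer_eq_two_iff hn).mpr h), fun k hk hkn => ?_⟩
    rcases hk.eq_or_lt with rfl | hk2
    · exact hf.one
    · exact (hb.twoStepCentralizer_eq_two_iff hk2).mp (heq k hk2 hkn)
  · intro hn
    have hn2 : 2 ≤ n := lt_of_le_of_ne hn.one_le (by rintro rfl; exact hn.ne_zero hf.one)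
    exact ⟨hn2, fun h => hn.ne_zero ((hb.twoStepCentralizer_eq_two_iff hn2).mp h), fun k hk hkn =>
      (hb.twoStepCentralizer_eq_two_iff hk).mpr (hn.eq_zero k (by lia) hkn)⟩

lemma eq_or_exists_isGap (hb : IsStandardBasis 𝒜 x y v a b) {n i j m : ℕ}
    (hn : IsFirstNonzero (centralizerSeq a b) n) (hc : IsConstituent 𝒜 i j m) :
    m = n ∨ ∃ k, IsGap (centralizerSeq a b) k m := by
  cases hc with
  | first _ hs =>
    rw [hb.secondOccursAt_iff] at hs
    exact Or.inl (le_antisymm (hs.le hn.one_le hn.ne_zero) (hn.le hs.one_le hs.ne_zero))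
  | later k _ hk hm hstart hend hmid =>
    have hiff : ∀ l, twoStepCentralizer 𝒜 (k + l) = twoStepCentralizer 𝒜 2 ↔
        centralizerSeq a b (k + l) = 0 := fun l => hb.twoStepCentralizer_eq_two_iff (by lia)
    exact Or.inr ⟨k, by lia, hm, (hiff 0).not.mp hstart, (hiff m).not.mp hend,
      fun l hl hlm => (hiff l).mp (hmid l hl hlm)⟩

variable {p : ℕ} [Fact p.Prime] [CharP F p]

theorem exists_isBlockSequence (hb : IsStandardBasis 𝒜 x y v a b) (hp : p ≠ 2)
    (hthree : 3 ≤ (twoStepCentralizers 𝒜).encard) :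
    ∃ h, 1 ≤ h ∧ IsBlockSequence (centralizerSeq a b) (p ^ h) := by
  have hchar : CharP (RatFunc F) p := charP_of_injective_algebraMap (algebraMap F _).injective p
  obtain ⟨k, hk, hne, -⟩ := exists_twoStepCentralizer_ne hthree (twoStepCentralizer 𝒜 2) ⊥
  exact hb.isCentralizerSequence.exists_isBlockSequence hp (by lia)
    ((hb.twoStepCentralizer_eq_two_iff hk).not.mp hne)

lemma exists_ne_zero_and_ne (hb : IsStandardBasis 𝒜 x y v a b)
    (hthree : 3 ≤ (twoStepCentralizers 𝒜).encard) {l : ℕ} (hl : 2 ≤ l) :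
    ∃ k, 1 ≤ k ∧ centralizerSeq a b k ≠ 0 ∧ centralizerSeq a b k ≠ centralizerSeq a b l := by
  obtain ⟨k, hk, hk2, hkl⟩ :=
    exists_twoStepCentralizer_ne hthree (twoStepCentralizer 𝒜 2) (twoStepCentralizer 𝒜 l)
  exact ⟨k, by lia, (hb.twoStepCentralizer_eq_two_iff hk).not.mp hk2,
    (hb.twoStepCentralizer_eq_iff_centralizerSeq_eq hk hl).not.mp hkl⟩

end IsStandardBasis

lemma inflationDerivation_tmul {F : Type*} [Field F] {p : ℕ} [CharP F p] {N : Type*} [LieRing N]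
    [LieAlgebra F N] (I : LieIdeal F N) (s : N) (t : Trunc F p) (m : I) :
    inflationDerivation p I s (t ⊗ₜ m) =
      truncDerivation F p t ⊗ₜ m + (eps F p ^ (p - 1) * t) ⊗ₜ ⁅s, m⁆ :=
  rfl

section Trunc

variable (F : Type*) [Field F] (p : ℕ)

lemma eps_pow_eq_zero {n : ℕ} (hn : p ≤ n) : eps F p ^ n = 0 := by
  rw [eps, ← map_pow, Ideal.Quotient.eq_zero_iff_mem, Ideal.mem_span_singleton]
  exact pow_dvd_pow _ hn

lemma exists_basis_eps_pow :
    ∃ B : Module.Basis (Fin p) F (Trunc F p), ∀ j, B j = eps F p ^ (j : ℕ) := by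
  let P := AdjoinRoot.powerBasis' (Polynomial.monic_X_pow p : (Polynomial.X ^ p : F[X]).Monic)
  have hdim : P.dim = p := Polynomial.natDegree_X_pow p
  have hpow (j : Fin p) :
      P.basis.reindex (finCongr hdim) j = AdjoinRoot.root (Polynomial.X ^ p) ^ (j : ℕ) := by
    rw [Module.Basis.reindex_apply, P.basis_eq_pow]
    rfl
  exact ⟨P.basis.reindex (finCongr hdim), hpow⟩

lemma truncDerivation_eps [CharP F p] : truncDerivation F p (eps F p) = 1 := by
  refine (Derivation.liftOfSurjective_apply (Ideal.Quotient.mkₐ_surjective F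
    (Ideal.span {(Polynomial.X : F[X]) ^ p})) (derivative_trunc F p) Polynomial.X).trans ?_
  simp [Polynomial.derivative']

/-- The divided power `ε ^ j / j!` in `F[ε]`, for `j < p`; for `j ≥ p` it is `0` by convention
when `F` has characteristic `p`. The derivation `∂` lowers the exponent of divided powers by one. -/
noncomputable def dividedPower (j : ℕ) : Trunc F p :=
  (j.factorial : F)⁻¹ • eps F p ^ j

lemma dividedPower_zero : dividedPower F p 0 = 1 := by
  rw [dividedPower, Nat.factorial_zero, Nat.cast_one, inv_one, pow_zero, one_smul]

lemma eps_pow_pred_mul_dividedPower_succ (j : ℕ) :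
    eps F p ^ (p - 1) * dividedPower F p (j + 1) = 0 := by
  rw [dividedPower, mul_smul_comm, ← pow_add, eps_pow_eq_zero F p (by lia), smul_zero]

lemma dividedPower_pred_mul_dividedPower_succ (j : ℕ) :
    dividedPower F p (p - 1) * dividedPower F p (j + 1) = 0 := by
  rw [dividedPower, smul_mul_assoc, eps_pow_pred_mul_dividedPower_succ, smul_zero]

variable [Fact p.Prime] [CharP F p]

lemma dividedPower_pred : dividedPower F p (p - 1) = -eps F p ^ (p - 1) := by
  have hwilson := congrArg (ZMod.castHom dvd_rfl F) (ZMod.wilsons_lemma p)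
  rw [map_natCast, map_neg, map_one] at hwilson
  rw [dividedPower, hwilson, inv_neg, inv_one, neg_one_smul]

lemma factorial_smul_dividedPower {j : ℕ} (hj : j < p) :
    (j.factorial : F) • dividedPower F p j = eps F p ^ j :=
  smul_inv_smul₀ ((IsUnit.natCast_factorial_iff_of_charP p).mpr hj).ne_zero _

lemma truncDerivation_dividedPower_succ {j : ℕ} (hj : j + 1 < p) :
    truncDerivation F p (dividedPower F p (j + 1)) = dividedPower F p j := by
  have hfactorial := ((IsUnit.natCast_factorial_iff_of_charP (A := F) p).mpr hj).ne_zero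
  rw [Nat.factorial_succ, Nat.cast_mul] at hfactorial
  rw [dividedPower, Derivation.map_smul, Derivation.leibniz_pow, truncDerivation_eps,
    Nat.add_sub_cancel, smul_eq_mul, mul_one, ← Nat.cast_smul_eq_nsmul F, smul_smul, dividedPower,
    Nat.factorial_succ, Nat.cast_mul, mul_inv_rev,
    inv_mul_cancel_right₀ (left_ne_zero_of_mul hfactorial)]

/-- The basis of `F[ε]` consisting of the divided powers of `ε`. -/
noncomputable def dividedPowerBasis : Module.Basis (Fin p) F (Trunc F p) :=
  (exists_basis_eps_pow F p).choose.isUnitSMul (w := fun j => ((j : ℕ).factorial : F)⁻¹)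
    fun j => ((IsUnit.natCast_factorial_iff_of_charP p).mpr j.2).inv

lemma dividedPowerBasis_apply (j : Fin p) : dividedPowerBasis F p j = dividedPower F p j := by
  rw [dividedPowerBasis, Module.Basis.isUnitSMul_apply, (exists_basis_eps_pow F p).choose_spec,
    dividedPower]

variable {F p} {N : Type*} [LieRing N] [LieAlgebra F N] (I : LieIdeal F N) (s : N)

lemma inflationDerivation_dividedPower_succ_tmul {j : ℕ} (hj : j + 1 < p) (m : I) :
    inflationDerivation p I s (dividedPower F p (j + 1) ⊗ₜ m) = dividedPower F p j ⊗ₜ m := by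
  rw [inflationDerivation_tmul, truncDerivation_dividedPower_succ F p hj,
    eps_pow_pred_mul_dividedPower_succ, TensorProduct.zero_tmul, add_zero]

lemma inflationDerivation_one_tmul (m : I) :
    inflationDerivation p I s (1 ⊗ₜ m) = -(dividedPower F p (p - 1) ⊗ₜ ⁅s, m⁆) := by
  rw [inflationDerivation_tmul, Derivation.map_one_eq_zero, TensorProduct.zero_tmul, zero_add,
    mul_one, dividedPower_pred, TensorProduct.neg_tmul, neg_neg]

end Trunc

namespace DerivExt

variable {F K : Type*} [Field F] [LieRing K] [LieAlgebra F K] (D : LieDerivation F K K)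

lemma lie_inl_inl (a b : K) : ⁅inl D a, inl D b⁆ = inl D ⁅a, b⁆ := by
  ext <;> simp [inl]

lemma lie_gen_inl (a : K) : ⁅gen D, inl D a⁆ = inl D (D a) := by
  ext <;> simp [inl, gen]

/-- The ideal `K` of `K ⊕ F·D`. -/
def leftIdeal : LieIdeal F (DerivExt D) where
  carrier := {z | z.right = 0}
  add_mem' ha hb := (congrArg₂ (· + ·) ha hb).trans (add_zero 0)
  zero_mem' := rfl
  smul_mem' c _ ha := (congrArg (c • ·) ha).trans (smul_zero c)
  lie_mem _ := rfl

/-- The decomposition of `K ⊕ F·D` as a direct sum of vector spaces. -/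
def prodEquiv : (K × F) ≃ₗ[F] DerivExt D where
  __ := (toProd (D := D)).symm
  map_add' _ _ := rfl
  map_smul' _ _ := rfl

/-- The basis of `K ⊕ F·D` obtained by adding `D`, indexed by `none`, to a basis of `K`. -/
noncomputable def basisOption {ι : Type*} (B : Module.Basis ι F K) :
    Module.Basis (Option ι) F (DerivExt D) :=
  ((B.prod (Module.Basis.singleton PUnit.{1} F)).map (prodEquiv D)).reindex
    (Equiv.optionEquivSumPUnit ι).symm

variable {ι : Type*} (B : Module.Basis ι F K)

lemma basisOption_none : basisOption D B none = gen D := by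
  simp [basisOption, prodEquiv, toProd, gen]

lemma basisOption_some (i : ι) : basisOption D B (some i) = inl D (B i) := by
  simp [basisOption, prodEquiv, toProd, inl]

end DerivExt

section WeightEquiv

variable (p : ℕ) [NeZero p]

/-- The bijection taking `(j, i)` to `p (i + 1) - j - 1`: in the inflation, the tensor product of
`ε ^ j` with an element of weight `i + 1` has weight `weightEquiv p (j, i) + 1`. -/
def weightEquiv : Fin p × ℕ ≃ ℕ :=
  (Fin.revPerm.prodCongr (Equiv.refl ℕ)).trans ((Equiv.prodComm _ _).trans (Nat.divModEquiv p).symm)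

lemma weightEquiv_add_one (j : Fin p) (i : ℕ) : weightEquiv p (j, i) + 1 = p * (i + 1) - j := by
  have hval : weightEquiv p (j, i) = i * p + (p - (j + 1)) := rfl
  rw [hval, mul_add, mul_comm, mul_one]
  lia

lemma exists_eq_mul_sub {k : ℕ} (hk : 1 ≤ k) : ∃ i j, j < p ∧ k = p * (i + 1) - j := by
  obtain ⟨⟨j, i⟩, h⟩ := (weightEquiv p).surjective (k - 1)
  exact ⟨i, j, j.2, by rw [← weightEquiv_add_one, h, Nat.sub_add_cancel hk]⟩

end WeightEquiv

lemma not_dvd_mul_add {p i r : ℕ} (hr : 1 ≤ r) (hrp : r < p) : ¬ p ∣ p * i + r := by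
  rw [Nat.dvd_add_right (dvd_mul_right p i)]
  exact Nat.not_dvd_of_pos_of_lt hr hrp

lemma mul_succ_sub_eq_mul_add {p i j : ℕ} (hj : j < p) : p * (i + 1) - j = p * i + (p - j) := by
  rw [mul_add, mul_one]
  lia

lemma not_dvd_mul_succ_sub {p i j : ℕ} (hj : 1 ≤ j) (hjp : j < p) : ¬ p ∣ p * (i + 1) - j := by
  rw [mul_succ_sub_eq_mul_add hjp]
  exact not_dvd_mul_add (by lia) (by lia)

namespace IsStandardBasis

variable {F L : Type*} [Field F] [LieRing L] [LieAlgebra F L]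
  {𝒜 : ℕ → Submodule F L} {x y : L} {v : ℕ → L} {a b : ℕ → F}

section Basis

variable [GradedLieAlgebra 𝒜]

lemma linearIndependent_v (hb : IsStandardBasis 𝒜 x y v a b) {f : ℕ → ℕ}
    (hf : Function.Injective f) (hpos : ∀ i, 1 ≤ f i) : LinearIndependent F fun i => v (f i) :=
  ((DirectSum.Decomposition.isInternal 𝒜).submodule_iSupIndep.comp hf).linearIndependent _
    (fun i => hb.v_mem (hpos i)) fun i => hb.v_ne_zero _ (hpos i)

lemma x_notMem_span (hb : IsStandardBasis 𝒜 x y v a b) :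
    x ∉ Submodule.span F (Set.range fun k => v (k + 1)) := by
  intro hx
  let π : L →ₗ[F] L := (𝒜 1).subtype ∘ₗ DirectSum.component F ℕ (𝒜 ·) 1 ∘ₗ
    (DirectSum.decomposeLinearEquiv 𝒜).toLinearMap
  have hπ : Submodule.span F (Set.range fun k => v (k + 1)) ≤ (Submodule.span F {y}).comap π := by
    rw [Submodule.span_le]
    rintro _ ⟨k, rfl⟩
    change (DirectSum.decompose 𝒜 (v (k + 1)) 1 : L) ∈ Submodule.span F {y}
    rcases k.eq_zero_or_pos with rfl | hk
    · rw [DirectSum.decompose_of_mem_same 𝒜 (hb.v_mem le_rfl), hb.v_one]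
      exact Submodule.mem_span_singleton_self _
    · rw [DirectSum.decompose_of_mem_ne 𝒜 (hb.v_mem (by lia)) (by lia)]
      exact zero_mem _
  have hxy : (DirectSum.decompose 𝒜 x 1 : L) ∈ Submodule.span F {y} := hπ hx
  rw [DirectSum.decompose_of_mem_same 𝒜 hb.x_mem] at hxy
  obtain ⟨c, hc⟩ := Submodule.mem_span_singleton.mp hxy
  have hpair := LinearIndependent.pair_iff.mp hb.linearIndependent 1 (-c)
    (by rw [neg_smul, hc, one_smul, add_neg_cancel])
  exact one_ne_zero hpair.1

lemma top_le_span (hb : IsStandardBasis 𝒜 x y v a b) :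
    ⊤ ≤ Submodule.span F
      (Set.range fun o : Option ℕ => Option.casesOn' o x fun k => v (k + 1)) := by
  rw [← (DirectSum.Decomposition.isInternal 𝒜).submodule_iSup_eq_top, iSup_le_iff]
  intro i
  match i with
  | 0 => rw [hb.zero_eq_bot]; exact bot_le
  | 1 =>
    rw [hb.span_one]
    refine Submodule.span_mono (Set.pair_subset ⟨none, rfl⟩ ⟨some 0, hb.v_one⟩)
  | i + 2 =>
    rw [hb.span _ (by lia), Submodule.span_singleton_le_iff_mem]
    exact Submodule.subset_span ⟨some (i + 1), rfl⟩

/-- A standard basis as a basis of the vector space `L`: `none` is the index of `x`, and `some k`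
is that of `v (k + 1)`. -/
noncomputable def basis (hb : IsStandardBasis 𝒜 x y v a b) : Module.Basis (Option ℕ) F L :=
  Module.Basis.mk (linearIndependent_option'.mpr
    ⟨hb.linearIndependent_v (add_left_injective 1) fun i => i.succ_pos, hb.x_notMem_span⟩)
    hb.top_le_span

lemma basis_none (hb : IsStandardBasis 𝒜 x y v a b) : hb.basis none = x :=
  Module.Basis.mk_apply _ _ _

lemma basis_some (hb : IsStandardBasis 𝒜 x y v a b) (k : ℕ) : hb.basis (some k) = v (k + 1) :=
  Module.Basis.mk_apply _ _ _

end Basis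

lemma lie_x_of_b_eq_zero (hb : IsStandardBasis 𝒜 x y v a b) {k : ℕ} (hk : 1 ≤ k)
    (hbk : b k = 0) : ⁅x, v k⁆ = v (k + 1) := by
  rw [hb.lie_x k hk, hb.a_eq_one hk hbk, one_smul]

lemma lie_y_of_b_eq_zero (hb : IsStandardBasis 𝒜 x y v a b) {k : ℕ} (hk : 1 ≤ k)
    (hbk : b k = 0) : ⁅y, v k⁆ = 0 := by
  rw [hb.lie_y k hk, hbk, zero_smul]

variable {p : ℕ}

lemma ad_x_pow_apply_v (hb : IsStandardBasis 𝒜 x y v a b)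
    (hdvd : ∀ k, ¬ p ∣ k → b k = 0) {i r : ℕ} (hr : r < p) :
    (LieAlgebra.ad F L x ^ r) (v (p * i + 1)) = v (p * i + (r + 1)) := by
  induction r with
  | zero => rfl
  | succ r ih =>
    rw [pow_succ', Module.End.mul_apply, ih (by lia), LieAlgebra.ad_apply,
      hb.lie_x_of_b_eq_zero (by lia) (hdvd _ (not_dvd_mul_add (by lia) hr))]
    rfl

lemma ad_x_pow_apply_v_mul (hb : IsStandardBasis 𝒜 x y v a b)
    (hdvd : ∀ k, ¬ p ∣ k → b k = 0) {i : ℕ} (hi : 1 ≤ p * i) :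
    (LieAlgebra.ad F L x ^ p) (v (p * i)) = a (p * i) • v (p * (i + 1)) := by
  obtain ⟨r, rfl⟩ := Nat.exists_eq_add_of_le' (pos_of_mul_pos_left hi i.zero_le)
  rw [pow_succ, Module.End.mul_apply, LieAlgebra.ad_apply, hb.lie_x _ hi, map_smul,
    hb.ad_x_pow_apply_v hdvd r.lt_succ_self]
  rfl

lemma lie_v_v_eq_zero (hb : IsStandardBasis 𝒜 x y v a b)
    (hdvd : ∀ k, ¬ p ∣ k → b k = 0) {i r t : ℕ} (ht : 1 ≤ t) (hrt : r + t < p) :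
    ⁅v (r + 1), v (p * i + t)⁆ = 0 := by
  have hbt : b (p * i + t) = 0 := hdvd _ (not_dvd_mul_add ht (by lia))
  induction r generalizing t with
  | zero => rw [zero_add, hb.v_one, hb.lie_y_of_b_eq_zero (by lia) hbt]
  | succ r ih =>
    have hbr : b (r + 1) = 0 := hdvd _ (Nat.not_dvd_of_pos_of_lt (by lia) (by lia))
    rw [← hb.lie_x_of_b_eq_zero (by lia) hbr, lie_lie, ih ht (by lia) hbt, lie_zero, zero_sub,
      hb.lie_x_of_b_eq_zero (by lia) hbt, add_assoc,
      ih (by lia) (by lia) (hdvd _ (not_dvd_mul_add (by lia) (by lia))), neg_zero]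

lemma lie_v_v_mul (hb : IsStandardBasis 𝒜 x y v a b)
    (hdvd : ∀ k, ¬ p ∣ k → b k = 0) {i r : ℕ} (hi : 1 ≤ p * i) (hr : r < p) :
    ⁅v (r + 1), v (p * i)⁆ = b (p * i) • v (p * i + (r + 1)) := by
  induction r with
  | zero => rw [zero_add, hb.v_one, hb.lie_y _ hi]
  | succ r ih =>
    have hbr : b (r + 1) = 0 := hdvd _ (Nat.not_dvd_of_pos_of_lt (by lia) hr)
    have hbi : b (p * i + (r + 1)) = 0 := hdvd _ (not_dvd_mul_add (by lia) (by lia))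
    rw [← hb.lie_x_of_b_eq_zero (by lia) hbr, lie_lie, ih (by lia), hb.lie_x _ hi, lie_smul,
      lie_smul, hb.lie_v_v_eq_zero hdvd le_rfl (by lia), smul_zero, sub_zero,
      hb.lie_x_of_b_eq_zero (by lia) hbi]
    rfl

end IsStandardBasis

namespace IsStandardBasis

variable {F L : Type*} [Field F] [LieRing L] [LieAlgebra F L]
  {𝒜 : ℕ → Submodule F L} [GradedLieAlgebra 𝒜] {x y : L} {v : ℕ → L} {a b : ℕ → F}
  {N : Type*} [LieRing N] [LieAlgebra F N] {I : LieIdeal F N} {p : ℕ} [Fact p.Prime] [CharP F p]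

/-- The linear isomorphism of `L` with an inflation which takes `x` to `D`, and `v (p (i + 1) - j)`
to the tensor product of the `j`-th divided power of `ε` with the `i`-th basis vector of `I`. -/
noncomputable def toInflation (p : ℕ) [Fact p.Prime] [CharP F p]
    (hb : IsStandardBasis 𝒜 x y v a b) (B : Module.Basis ℕ F I) (s : N) :
    L ≃ₗ[F] Inflation p I s :=
  hb.basis.equiv (DerivExt.basisOption _ ((dividedPowerBasis F p).tensorProduct B))
    (Equiv.optionCongr (weightEquiv p)).symm

variable (hb : IsStandardBasis 𝒜 x y v a b) (B : Module.Basis ℕ F I) (s : N)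

lemma toInflation_x : hb.toInflation p B s x = DerivExt.gen _ := by
  refine (congrArg (hb.toInflation p B s) hb.basis_none).symm.trans ?_
  rw [toInflation, Module.Basis.equiv_apply]
  exact DerivExt.basisOption_none _ _

lemma toInflation_v {i j : ℕ} (hj : j < p) :
    hb.toInflation p B s (v (p * (i + 1) - j)) =
      DerivExt.inl _ (dividedPower F p j ⊗ₜ B i) := by
  have hindex : (Equiv.optionCongr (weightEquiv p)).symm (some (weightEquiv p (⟨j, hj⟩, i))) =
      some (⟨j, hj⟩, i) := congrArg some ((weightEquiv p).symm_apply_apply _)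
  rw [← weightEquiv_add_one p ⟨j, hj⟩ i, ← hb.basis_some, toInflation, Module.Basis.equiv_apply,
    hindex, DerivExt.basisOption_some, Module.Basis.tensorProduct_apply, dividedPowerBasis_apply]

lemma toInflation_v_mul_add_one (i : ℕ) :
    hb.toInflation p B s (v (p * i + 1)) =
      DerivExt.inl _ (dividedPower F p (p - 1) ⊗ₜ B i) := by
  have hp := (Fact.out : p.Prime).pos
  rw [← hb.toInflation_v B s (by lia), mul_succ_sub_eq_mul_add (by lia),
    Nat.sub_sub_self (by lia)]

lemma toInflation_y :
    hb.toInflation p B s y = DerivExt.inl _ (dividedPower F p (p - 1) ⊗ₜ B 0) := by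
  rw [← hb.toInflation_v_mul_add_one, mul_zero, zero_add, hb.v_one]

variable {B s}

lemma map_lie_of_forall_v (hb : IsStandardBasis 𝒜 x y v a b) {L' : Type*} [LieRing L']
    [LieAlgebra F L'] {φ : L →ₗ[F] L'} {u : L} (hx : φ ⁅u, x⁆ = ⁅φ u, φ x⁆)
    (hv : ∀ k, 1 ≤ k → φ ⁅u, v k⁆ = ⁅φ u, φ (v k)⁆) (w : L) : φ ⁅u, w⁆ = ⁅φ u, φ w⁆ := by
  refine LinearMap.congr_fun (f := φ ∘ₗ LieAlgebra.ad F L u)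
    (g := LieAlgebra.ad F L' (φ u) ∘ₗ φ) (hb.basis.ext ?_) w
  rintro (_ | k)
  · rw [hb.basis_none]; exact hx
  · rw [hb.basis_some]; exact hv _ k.succ_pos

/-- In `D (1 ⊗ m) = ε ^ (p - 1) ⊗ ⁅s, m⁆` the power of `ε` is minus a divided power, by Wilson's
theorem; this is why `s` has to act as the negative of the deflation of `x`. -/
lemma toInflation_lie_x (hdvd : ∀ k, ¬ p ∣ k → b k = 0)
    (hs : ∀ i, ⁅s, B i⁆ = -(a (p * (i + 1)) • B (i + 1))) (w : L) :
    hb.toInflation p B s ⁅x, w⁆ = ⁅hb.toInflation p B s x, hb.toInflation p B s w⁆ := by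
  refine hb.map_lie_of_forall_v (φ := (hb.toInflation p B s).toLinearMap)
    (by rw [lie_self, lie_self, map_zero]) (fun k hk => ?_) w
  obtain ⟨i, j, hj, rfl⟩ := exists_eq_mul_sub p hk
  rw [LinearEquiv.coe_coe, toInflation_x, hb.toInflation_v B s hj, DerivExt.lie_gen_inl]
  rcases j with _ | j
  · rw [Nat.sub_zero] at hk ⊢
    rw [hb.lie_x _ hk, map_smul, toInflation_v_mul_add_one, dividedPower_zero,
      inflationDerivation_one_tmul, hs, TensorProduct.tmul_neg, neg_neg, TensorProduct.tmul_smul,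
      map_smul]
  · have hbk : b (p * (i + 1) - (j + 1)) = 0 := hdvd _ (not_dvd_mul_succ_sub (by lia) hj)
    rw [hb.lie_x_of_b_eq_zero hk hbk, Nat.sub_add_eq, Nat.sub_add_cancel (by lia),
      hb.toInflation_v B s (by lia), inflationDerivation_dividedPower_succ_tmul I s hj]

lemma toInflation_lie_y (hdvd : ∀ k, ¬ p ∣ k → b k = 0)
    (hs : ∀ i, ⁅s, B i⁆ = -(a (p * (i + 1)) • B (i + 1)))
    (hB : ∀ i, ⁅B 0, B i⁆ = b (p * (i + 1)) • B (i + 1)) (w : L) :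
    hb.toInflation p B s ⁅y, w⁆ = ⁅hb.toInflation p B s y, hb.toInflation p B s w⁆ := by
  refine hb.map_lie_of_forall_v (φ := (hb.toInflation p B s).toLinearMap) ?_ (fun k hk => ?_) w
  · rw [← lie_skew, map_neg, LinearEquiv.coe_coe, hb.toInflation_lie_x hdvd hs, lie_skew]
  obtain ⟨i, j, hj, rfl⟩ := exists_eq_mul_sub p hk
  rw [LinearEquiv.coe_coe, toInflation_y, hb.toInflation_v B s hj, DerivExt.lie_inl_inl,
    LieAlgebra.ExtendScalars.bracket_tmul]
  rcases j with _ | j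
  · rw [Nat.sub_zero] at hk ⊢
    rw [hb.lie_y _ hk, map_smul, toInflation_v_mul_add_one, dividedPower_zero,
      mul_one, hB, TensorProduct.tmul_smul, map_smul]
  · have hbk : b (p * (i + 1) - (j + 1)) = 0 := hdvd _ (not_dvd_mul_succ_sub (by lia) hj)
    rw [hb.lie_y_of_b_eq_zero hk hbk, map_zero, dividedPower_pred_mul_dividedPower_succ,
      TensorProduct.zero_tmul, map_zero]

lemma toInflation_lie (hdvd : ∀ k, ¬ p ∣ k → b k = 0)
    (hgen : LieSubalgebra.lieSpan F L (𝒜 1 : Set L) = ⊤)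
    (hs : ∀ i, ⁅s, B i⁆ = -(a (p * (i + 1)) • B (i + 1)))
    (hB : ∀ i, ⁅B 0, B i⁆ = b (p * (i + 1)) • B (i + 1)) (u w : L) :
    hb.toInflation p B s ⁅u, w⁆ = ⁅hb.toInflation p B s u, hb.toInflation p B s w⁆ := by
  refine map_lie_of_lieSpan_eq_top hgen (hb.toInflation p B s).toLinearMap (fun u hu w => ?_) u w
  obtain ⟨α, β, rfl⟩ := Submodule.mem_span_pair.mp (hb.span_one ▸ hu)
  simp only [LinearEquiv.coe_coe, add_lie, smul_lie, map_add, map_smul,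
    hb.toInflation_lie_x hdvd hs, hb.toInflation_lie_y hdvd hs hB]

section Grading

variable {ℬ : ℕ → Submodule F N}

lemma toInflation_v_mem (hB : ∀ i, (B i : N) ∈ ℬ (i + 1)) {k : ℕ} (hk : 1 ≤ k) :
    hb.toInflation p B s (v k) ∈ inflationGrading p ℬ I s k := by
  obtain ⟨i, j, hj, rfl⟩ := exists_eq_mul_sub p hk
  rw [hb.toInflation_v B s hj, dividedPower, ← TensorProduct.smul_tmul', map_smul]
  exact Submodule.mem_sup_left (Submodule.smul_mem _ _
    (Submodule.subset_span ⟨i + 1, j, B i, hj, Nat.sub_add_cancel (by lia), hB i, rfl⟩))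

lemma map_toInflation_le (hB : ∀ i, (B i : N) ∈ ℬ (i + 1)) (k : ℕ) :
    (𝒜 k).map (hb.toInflation p B s).toLinearMap ≤ inflationGrading p ℬ I s k := by
  rw [Submodule.map_le_iff_le_comap]
  match k with
  | 0 => rw [hb.zero_eq_bot]; exact bot_le
  | 1 =>
    rw [hb.span_one, Submodule.span_le]
    refine Set.pair_subset ?_ (hb.v_one ▸ hb.toInflation_v_mem hB le_rfl)
    change hb.toInflation p B s x ∈ inflationGrading p ℬ I s 1
    rw [toInflation_x, inflationGrading, if_pos rfl]
    exact Submodule.mem_sup_right (Submodule.mem_span_singleton_self _)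
  | k + 2 =>
    rw [hb.span _ (by lia), Submodule.span_singleton_le_iff_mem]
    exact hb.toInflation_v_mem hB (by lia)

lemma le_map_toInflation (hzero : ∀ m : I, (m : N) ∈ ℬ 0 → m = 0)
    (hsucc : ∀ i (m : I), (m : N) ∈ ℬ (i + 1) → ∃ c : F, m = c • B i) (k : ℕ) :
    inflationGrading p ℬ I s k ≤ (𝒜 k).map (hb.toInflation p B s).toLinearMap := by
  refine sup_le (Submodule.span_le.mpr ?_) ?_
  · rintro _ ⟨_ | i, j, m, hj, hkj, hm, rfl⟩
    · rw [hzero m hm, TensorProduct.tmul_zero, map_zero]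
      exact zero_mem _
    · obtain ⟨c, rfl⟩ := hsucc i m hm
      obtain rfl : k = p * (i + 1) - j := by lia
      have hv : v (p * (i + 1) - j) ∈ 𝒜 (p * (i + 1) - j) :=
        hb.v_mem (by rw [mul_succ_sub_eq_mul_add hj]; lia)
      refine ⟨(c * j.factorial) • v (p * (i + 1) - j), Submodule.smul_mem _ _ hv, ?_⟩
      rw [LinearEquiv.coe_coe, map_smul, hb.toInflation_v B s hj,
        ← factorial_smul_dividedPower F p hj, ← TensorProduct.smul_tmul', TensorProduct.tmul_smul,
        map_smul, map_smul, mul_smul, smul_comm]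
  · split_ifs with hk
    · rw [Submodule.span_singleton_le_iff_mem, hk]
      exact ⟨x, hb.x_mem, hb.toInflation_x B s⟩
    · exact bot_le

end Grading

end IsStandardBasis

lemma two_le_mul_succ (p : ℕ) [Fact p.Prime] (i : ℕ) : 2 ≤ p * (i + 1) :=
  (Fact.out : p.Prime).two_le.trans (Nat.le_mul_of_pos_right p i.succ_pos)

lemma one_le_mul_succ (p : ℕ) [Fact p.Prime] (i : ℕ) : 1 ≤ p * (i + 1) :=
  one_le_two.trans (two_le_mul_succ p i)

section Deflation

variable {F L : Type*} [Field F] [LieRing L] [LieAlgebra F L] {𝒜 : ℕ → Submodule F L}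
  [GradedLieAlgebra 𝒜] (p : ℕ) [Fact p.Prime] [CharP F p]

/-- The ideal `⨁_i L_{pi}` of the deflation of `L`. -/
abbrev multiplesIdeal (z : 𝒜 1) : LieIdeal F (Deflation p 𝒜 z) :=
  DerivExt.leftIdeal (adPowDerivation p 𝒜 z)

/-- The inclusion of the ideal `⨁_i L_{pi}` of the deflation in `L`. -/
def multiplesIdealIncl (z : 𝒜 1) : multiplesIdeal p z →ₗ[F] L where
  toFun m := ((m : Deflation p 𝒜 z).left : L)
  map_add' _ _ := rfl
  map_smul' _ _ := rfl

lemma multiplesIdealIncl_injective (z : 𝒜 1) : Function.Injective (multiplesIdealIncl p z) :=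
  fun m m' h => Subtype.ext (DerivExt.ext (Subtype.ext h) (m.2.trans m'.2.symm))

lemma multiplesIdealIncl_lie {z : 𝒜 1} (m m' : multiplesIdeal p z) :
    multiplesIdealIncl p z ⁅m, m'⁆ = ⁅multiplesIdealIncl p z m, multiplesIdealIncl p z m'⁆ := by
  obtain ⟨⟨m, r⟩, hm⟩ := m
  obtain rfl : r = 0 := hm
  obtain ⟨⟨m', r'⟩, hm'⟩ := m'
  obtain rfl : r' = 0 := hm'
  exact congrArg (fun d : Deflation p 𝒜 z => (d.left : L)) (DerivExt.lie_inl_inl _ m m')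

lemma multiplesIdealIncl_gen_lie {z : 𝒜 1} (m : multiplesIdeal p z) :
    multiplesIdealIncl p z ⁅DerivExt.gen (adPowDerivation p 𝒜 z), m⁆ =
      (LieAlgebra.ad F L (z : L) ^ p) (multiplesIdealIncl p z m) := by
  obtain ⟨⟨m, r⟩, hm⟩ := m
  obtain rfl : r = 0 := hm
  exact congrArg (fun d : Deflation p 𝒜 z => (d.left : L)) (DerivExt.lie_gen_inl _ m)

lemma multiplesIdealIncl_mem {z : 𝒜 1} {k : ℕ} {m : multiplesIdeal p z}
    (hm : (m : Deflation p 𝒜 z) ∈ deflationGrading p 𝒜 z k) :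
    multiplesIdealIncl p z m ∈ 𝒜 (p * k) := by
  have hle : deflationGrading p 𝒜 z k ≤ (𝒜 (p * k)).comap
      ((multiplesSubalgebra p 𝒜).toSubmodule.subtype ∘ₗ
        LinearMap.fst F _ _ ∘ₗ (DerivExt.prodEquiv _).symm.toLinearMap) := by
    refine sup_le ?_ ?_
    · rintro _ ⟨a, ha, rfl⟩
      exact ha
    · split_ifs
      · rw [Submodule.span_singleton_le_iff_mem]
        exact zero_mem (𝒜 (p * k))
      · exact bot_le
  exact hle hm

namespace IsStandardBasis

variable {x y : L} {v : ℕ → L} {a b : ℕ → F} (hb : IsStandardBasis 𝒜 x y v a b)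

/-- The element `v (p (i + 1))` of the ideal `⨁_i L_{pi}` of the deflation; it has weight
`i + 1`. -/
def deflationVec (i : ℕ) : multiplesIdeal p ⟨x, hb.x_mem⟩ :=
  ⟨DerivExt.inl _ ⟨v (p * (i + 1)), Submodule.mem_iSup_of_mem (i + 1)
    (hb.v_mem (one_le_mul_succ p i))⟩, rfl⟩

lemma multiplesIdealIncl_deflationVec (i : ℕ) :
    multiplesIdealIncl p _ (hb.deflationVec p i) = v (p * (i + 1)) :=
  rfl

lemma linearIndependent_deflationVec : LinearIndependent F (hb.deflationVec p) :=
  LinearIndependent.of_comp (multiplesIdealIncl p _) <| hb.linearIndependent_v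
    (fun _ _ h => Nat.succ_injective (Nat.eq_of_mul_eq_mul_left (Fact.out : p.Prime).pos h))
    (one_le_mul_succ p)

lemma top_le_span_deflationVec : ⊤ ≤ Submodule.span F (Set.range (hb.deflationVec p)) := by
  intro m _
  have hle : ⨆ i, 𝒜 (p * i) ≤
      (Submodule.span F (Set.range (hb.deflationVec p))).map (multiplesIdealIncl p _) := by
    rw [iSup_le_iff]
    rintro (_ | i)
    · rw [mul_zero, hb.zero_eq_bot]
      exact bot_le
    · rw [hb.span _ (two_le_mul_succ p i), Submodule.span_singleton_le_iff_mem]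
      exact ⟨hb.deflationVec p i, Submodule.subset_span ⟨i, rfl⟩, rfl⟩
  obtain ⟨m', hm', heq⟩ := hle (m : Deflation p 𝒜 ⟨x, hb.x_mem⟩).left.2
  rwa [← multiplesIdealIncl_injective p _ heq]

/-- The basis of the ideal `⨁_i L_{pi}` of the deflation given by a standard basis of `L`. -/
noncomputable def deflationBasis : Module.Basis ℕ F (multiplesIdeal p ⟨x, hb.x_mem⟩) :=
  Module.Basis.mk (hb.linearIndependent_deflationVec p) (hb.top_le_span_deflationVec p)

lemma deflationBasis_apply (i : ℕ) : hb.deflationBasis p i = hb.deflationVec p i :=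
  Module.Basis.mk_apply _ _ _

lemma deflationVec_mem (i : ℕ) :
    (hb.deflationVec p i : Deflation p 𝒜 ⟨x, hb.x_mem⟩) ∈
      deflationGrading p 𝒜 ⟨x, hb.x_mem⟩ (i + 1) :=
  Submodule.mem_sup_left ⟨_, hb.v_mem (one_le_mul_succ p i), rfl⟩

variable {p}

lemma exists_eq_smul_deflationVec (i : ℕ) (m : multiplesIdeal p ⟨x, hb.x_mem⟩)
    (hm : (m : Deflation p 𝒜 ⟨x, hb.x_mem⟩) ∈ deflationGrading p 𝒜 ⟨x, hb.x_mem⟩ (i + 1)) :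
    ∃ c : F, m = c • hb.deflationVec p i := by
  have hincl := multiplesIdealIncl_mem p hm
  rw [hb.span _ (two_le_mul_succ p i)] at hincl
  obtain ⟨c, hc⟩ := Submodule.mem_span_singleton.mp hincl
  refine ⟨c, multiplesIdealIncl_injective p _ ?_⟩
  rw [map_smul, multiplesIdealIncl_deflationVec, hc]

lemma eq_zero_of_mem_deflationGrading_zero (m : multiplesIdeal p ⟨x, hb.x_mem⟩)
    (hm : (m : Deflation p 𝒜 ⟨x, hb.x_mem⟩) ∈ deflationGrading p 𝒜 ⟨x, hb.x_mem⟩ 0) : m = 0 := by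
  have hincl := multiplesIdealIncl_mem p hm
  rw [mul_zero, hb.zero_eq_bot, Submodule.mem_bot] at hincl
  exact multiplesIdealIncl_injective p _ (hincl.trans (map_zero _).symm)

lemma multiplesIdeal_toSubmodule :
    (multiplesIdeal p ⟨x, hb.x_mem⟩).toSubmodule =
      Submodule.span F {(hb.deflationVec p 0 : Deflation p 𝒜 ⟨x, hb.x_mem⟩)} ⊔
        ⨆ i, ⨆ (_ : 2 ≤ i), deflationGrading p 𝒜 ⟨x, hb.x_mem⟩ i := by
  refine le_antisymm (fun m hm => ?_) (sup_le ?_ (iSup₂_le fun i hi => ?_))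
  · have hspan := Submodule.mem_map_of_mem
      (f := (multiplesIdeal p ⟨x, hb.x_mem⟩).toSubmodule.subtype)
      (hb.top_le_span_deflationVec p (Submodule.mem_top (x := ⟨m, hm⟩)))
    rw [Submodule.map_span] at hspan
    refine Submodule.span_le.mpr ?_ hspan
    rintro _ ⟨_, ⟨_ | i, rfl⟩, rfl⟩
    · exact Submodule.mem_sup_left (Submodule.mem_span_singleton_self _)
    · exact Submodule.mem_sup_right (Submodule.mem_iSup_of_mem (i + 2)
        (Submodule.mem_iSup_of_mem (by lia) (hb.deflationVec_mem p (i + 1))))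
  · rw [Submodule.span_singleton_le_iff_mem]
    exact (hb.deflationVec p 0).2
  · rw [deflationGrading, if_neg (by lia), sup_bot_eq]
    rintro _ ⟨_, -, rfl⟩
    rfl

lemma lie_neg_gen_deflationVec (hdvd : ∀ k, ¬ p ∣ k → b k = 0) (i : ℕ) :
    ⁅-DerivExt.gen (adPowDerivation p 𝒜 ⟨x, hb.x_mem⟩), hb.deflationVec p i⁆ =
      -(a (p * (i + 1)) • hb.deflationVec p (i + 1)) := by
  rw [neg_lie, neg_inj]
  refine multiplesIdealIncl_injective p _ ?_
  rw [multiplesIdealIncl_gen_lie, map_smul, multiplesIdealIncl_deflationVec,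
    multiplesIdealIncl_deflationVec, hb.ad_x_pow_apply_v_mul hdvd (one_le_mul_succ p i)]

lemma lie_deflationVec_zero (hdvd : ∀ k, ¬ p ∣ k → b k = 0) (i : ℕ) :
    ⁅hb.deflationVec p 0, hb.deflationVec p i⁆ =
      b (p * (i + 1)) • hb.deflationVec p (i + 1) := by
  have hp := (Fact.out : p.Prime).pos
  have hlie := hb.lie_v_v_mul hdvd (one_le_mul_succ p i) (Nat.sub_lt hp one_pos)
  rw [Nat.sub_add_cancel (show 1 ≤ p from hp), ← Nat.mul_succ] at hlie
  refine multiplesIdealIncl_injective p _ ?_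
  rw [multiplesIdealIncl_lie, map_smul, multiplesIdealIncl_deflationVec,
    multiplesIdealIncl_deflationVec, multiplesIdealIncl_deflationVec, zero_add, mul_one, hlie]

lemma neg_gen_notMem_span_deflationVec :
    -DerivExt.gen (adPowDerivation p 𝒜 ⟨x, hb.x_mem⟩) ∉
      Submodule.span F {(hb.deflationVec p 0 : Deflation p 𝒜 ⟨x, hb.x_mem⟩)} := by
  intro h
  obtain ⟨c, hc⟩ := Submodule.mem_span_singleton.mp h
  have hright : c * 0 = (-1 : F) := congrArg DerivExt.right hc
  rw [mul_zero] at hright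
  exact neg_ne_zero.mpr one_ne_zero hright.symm

theorem isInflated (hb : IsStandardBasis 𝒜 x y v a b)
    (hgen : LieSubalgebra.lieSpan F L (𝒜 1 : Set L) = ⊤)
    (hdvd : ∀ k, ¬ p ∣ k → b k = 0) : IsInflated p 𝒜 := by
  have hs (i : ℕ) : ⁅-DerivExt.gen (adPowDerivation p 𝒜 ⟨x, hb.x_mem⟩), hb.deflationBasis p i⁆ =
      -(a (p * (i + 1)) • hb.deflationBasis p (i + 1)) := by
    rw [deflationBasis_apply, deflationBasis_apply, hb.lie_neg_gen_deflationVec hdvd]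
  have hlie (i : ℕ) : ⁅hb.deflationBasis p 0, hb.deflationBasis p i⁆ =
      b (p * (i + 1)) • hb.deflationBasis p (i + 1) := by
    simp only [deflationBasis_apply, hb.lie_deflationVec_zero hdvd]
  refine ⟨⟨x, hb.x_mem⟩, hb.x_notMem_twoStepCentralizer_two,
    Submodule.span F {(hb.deflationVec p 0 : Deflation p 𝒜 ⟨x, hb.x_mem⟩)},
    (Submodule.span_singleton_le_iff_mem _ _).mpr (hb.deflationVec_mem p 0),
    finrank_span_singleton fun h =>
      (hb.linearIndependent_deflationVec p).ne_zero 0 (Subtype.ext h),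
    multiplesIdeal p ⟨x, hb.x_mem⟩, hb.multiplesIdeal_toSubmodule,
    -DerivExt.gen (adPowDerivation p 𝒜 ⟨x, hb.x_mem⟩), Submodule.mem_sup_right ?_,
    hb.neg_gen_notMem_span_deflationVec,
    { hb.toInflation p (hb.deflationBasis p) _ with
      map_lie' := fun {u w} => hb.toInflation_lie hdvd hgen hs hlie u w },
    fun k => le_antisymm (hb.map_toInflation_le (fun i => ?_) k)
      (hb.le_map_toInflation hb.eq_zero_of_mem_deflationGrading_zero (fun i m hm => ?_) k)⟩
  · rw [if_pos rfl]
    exact neg_mem (Submodule.mem_span_singleton_self _)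
  · rw [deflationBasis_apply]
    exact hb.deflationVec_mem p i
  · rw [deflationBasis_apply]
    exact hb.exists_eq_smul_deflationVec i m hm

end IsStandardBasis

end Deflation

end MaximalClass

theorem mainTheorem3 {F L : Type*} [Field F] [LieRing L] [LieAlgebra F L]
    (p : ℕ) [Fact p.Prime] [CharP F p] (hp : p ≠ 2)
    (𝒜 : ℕ → Submodule F L) [GradedLieAlgebra 𝒜] (hL : MaximalClass.IsMaximalClass 𝒜)
    (hinf : ¬ Module.Finite F L)
    (hthree : 3 ≤ (MaximalClass.twoStepCentralizers 𝒜).encard) :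
    (∃ h : ℕ, 1 ≤ h ∧ MaximalClass.IsParameter 𝒜 (p ^ h) ∧
      ∀ a b m : ℕ, MaximalClass.IsConstituent 𝒜 a b m → m = p ^ h ∨ m = 2 * p ^ h) ∧
    MaximalClass.IsInflated p 𝒜 := by
  obtain ⟨x, y, v, a, b, hb⟩ := hL.exists_isStandardBasis hinf
  obtain ⟨h, hh, hf⟩ := hb.exists_isBlockSequence hp hthree
  have hex := hb.exists_ne_zero_and_ne hthree (l := 2 * p ^ h) (by have := hf.two_le; lia)
  refine ⟨⟨h, hh, hb.secondOccursAt_iff.mpr hf.first, fun i j m hc => ?_⟩,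
    hb.isInflated hL.generated fun k hpk => ?_⟩
  · obtain rfl | ⟨k, hgap⟩ := hb.eq_or_exists_isGap hf.first hc
    · exact Or.inr rfl
    · exact hf.gap_eq hex hgap
  · have hk : 1 ≤ k := Nat.pos_of_ne_zero fun hk0 => hpk (hk0 ▸ dvd_zero p)
    rw [← MaximalClass.centralizerSeq_eq_zero_iff (hb.ne_zero_or_ne_zero hk)]
    by_contra hfk
    exact hpk ((dvd_pow_self p (by lia)).trans (hf.dvd_of_ne_zero hex hk hfk))
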